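/- Let $q>0$ be real. For integers $d\ge1$ and real $r>0$ let $$C_{d,q,r}=2^{-d}\,\mathrm{vol}\bigl([-1,1]^d\cap\{x\in\mathbb R^d:\|x\|_q\le r\}\bigr),\qquad \|x\|_q=\Bigl(\sum_{i=1}^d|x_i|^q\Bigr)^{1/q},$$ be the fraction of the cube $[-1,1]^d$ covered by the $L_q$-ball of radius $r$ centred at the origin, and put $$t_r=\frac{\sqrt{2q+1}\,\bigl((q+1)r^q-d\bigr)}{q\sqrt d},\qquad A_{d,q,r}=\Phi(t_r)+\frac{(1-t_r^2)\,\phi(t_r)}{6\sqrt d}\cdot\frac{2(q-1)\sqrt{2q+1}}{3q+1},$$ where $\Phi$ and $\phi(t)=\frac1{\sqrt{2\pi}}e^{-t^2/2}$ are the distribution function and the density of the standard normal law. Then: 1. For all $d\ge1$ and $r>0$, if $\mathbf x$ is uniformly distributed on $[-1,1]^d$ and $z_1,\dots,z_d$ are independent and uniformly distributed on $[0,1]$, then $$C_{d,q,r}=\mathbb P\{\|\mathbf x\|_q^q\le r^q\}=\mathbb P\Bigl\{\sum_{i=1}^d z_i^q\le r^q\Bigr\}.$$ 2. If $z$ is uniformly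 distributed on $[0,1]$, the third cumulant (third central moment) of $z^q$ is $$\mathrm{cum}_3(z^q)=\frac{2q^3(q-1)}{(3q+1)(2q+1)(q+1)^3}.$$ Moreover, with $\mu=\mathbb E(z^q)$ and $\sigma^2=\mathrm{Var}(z^q)$, for all $d\ge1$ and $r>0$, $$t_r=\frac{r^q-d\mu}{\sigma\sqrt d},\qquad A_{d,q,r}=\Phi(t_r)+\frac{(1-t_r^2)\,\phi(t_r)}{6\sqrt d}\cdot\frac{\mathrm{cum}_3(z^q)}{\sigma^3},$$ that is, $A_{d,q,r}$ is the first-order Edgeworth expansion for the standardized sum of $d$ independent copies of $z^q$, evaluated at $t_r$. 3. The error of the approximation $C_{d,q,r}\approx A_{d,q,r}$ is $o(d^{-1/2})$ uniformly in the radius: $$\lim_{d\to\infty}\ \sqrt d\,\sup_{r>0}\bigl|C_{d,q,r}-A_{d,q,r}\bigr|=0 .$$ -/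

import Mathlib

open MeasureTheory ProbabilityTheory Set

noncomputable section

/-- The `L_q`-norm `‖x‖_q = (∑ |x_i|^q)^(1/q)` on `ℝ^d` (only a quasi-norm for `q < 1`). -/
def lqNorm {d : ℕ} (q : ℝ) (x : Fin d → ℝ) : ℝ :=
  (∑ i, |x i| ^ q) ^ (1 / q)

/-- The `L_q`-ball of radius `r` centred at the origin of `ℝ^d`. -/
def lqBall (d : ℕ) (q r : ℝ) : Set (Fin d → ℝ) :=
  {x | lqNorm q x ≤ r}

/-- The cube `[-1,1]^d`. -/
def cube (d : ℕ) : Set (Fin d → ℝ) :=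
  Set.pi Set.univ (fun _ => Icc (-1 : ℝ) 1)

/-- The fraction of the cube `[-1,1]^d` covered by the `L_q`-ball of radius `r`. -/
def coveredFraction (d : ℕ) (q r : ℝ) : ℝ :=
  (volume (cube d ∩ lqBall d q r)).toReal / 2 ^ d

/-- The distribution function of the standard normal law. -/
def stdNormalCDF (t : ℝ) : ℝ := cdf (gaussianReal 0 1) t

/-- The density of the standard normal law. -/
def stdNormalPDF (t : ℝ) : ℝ := gaussianPDFReal 0 1 t

/-- The third cumulant (the third central moment) of a random variable. -/
def thirdCumulant {Ω : Type*} [MeasurableSpace Ω] (X : Ω → ℝ) (P : Measure Ω) : ℝ :=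
  centralMoment X 3 P

/-- The first-order Edgeworth expansion at `t` for the standardized sum of `n` independent copies
of the random variable `X`. -/
def firstOrderEdgeworth {Ω : Type*} [MeasurableSpace Ω] (X : Ω → ℝ) (P : Measure Ω)
    (n : ℕ) (t : ℝ) : ℝ :=
  stdNormalCDF t + (1 - t ^ 2) * stdNormalPDF t / (6 * √(n : ℝ)) *
    (thirdCumulant X P / √(variance X P) ^ 3)

/-- The argument `t_r` of the normal approximation. -/
def normalArg (d : ℕ) (q r : ℝ) : ℝ :=
  √(2 * q + 1) * ((q + 1) * r ^ q - d) / (q * √(d : ℝ))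

/-- The right-hand side of the improved normal approximation. -/
def improvedNormalApprox (d : ℕ) (q r : ℝ) : ℝ :=
  stdNormalCDF (normalArg d q r) +
    (1 - normalArg d q r ^ 2) * stdNormalPDF (normalArg d q r) / (6 * √(d : ℝ)) *
      (2 * (q - 1) * √(2 * q + 1) / (3 * q + 1))

end

/-!
The covered fraction is a probability: scaling the uniform law on the cube to mass one and taking
absolute values of the coordinates turns it into the product of uniform laws on `[0, 1]`
(`map_abs_cond_volume_cube`), so `coveredFraction d q r` is the distribution function of a sum of
`d` independent copies of `z ^ q` (`coveredFraction_eq_cdf`, after centring). The moments of `z ^ q`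
are elementary integrals and identify `improvedNormalApprox` with the first-order Edgeworth
expansion.

The error term is controlled by Fourier inversion. Let `S` be the centred sum, `v` and `m` the
variance and third cumulant of one summand and `φ` its characteristic function. The distribution
function of `S` minus its Edgeworth approximation is integrable, and its Fourier transform at
`s ≠ 0` is `-E s / (i s)` with
`E s = φ s ^ d - exp (-d v s² / 2) (1 + d m (i s)³ / 6)`
(`integral_cdf_sub_edgeworthCDF_mul_exp`). For each `q > 0` the function `φ` decays like a power of
`|s|`, so this transform is integrable, and inversion bounds the error uniformly by
`∫ |E s| / |s| ds` (`abs_cdf_sub_edgeworthCDF_le`); no smoothing kernel is needed.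

Near the origin, Taylor expansion compares `φ` with `exp (-v s² / 2 + m (i s)³ / 6)`, and
`|E s| ≤ (2 d s⁴ + d² s⁶) exp (-d v s² / 8)` (`norm_edgeworthCharError_pow_le`), which contributes
`O(1 / d)`. Away from the origin `|φ|` is at most some `ρ < 1`, because it is less than one at each
`s ≠ 0` and tends to zero at infinity; this contributes a geometrically small term. The two
properties of `φ` come from `φ` being, up to a phase, the oscillatory integral of `exp (i s z ^ q)`
over `[0, 1]`: integration by parts away from zero gives the decay
(`norm_integral_exp_mul_rpow_le`), and strict convexity of the disc gives `|φ s| < 1`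
(`norm_integral_exp_mul_rpow_lt_one`). The total error is `O(1 / d)`, in particular `o(d ^ (-1/2))`.
-/

open Filter Topology FourierTransform
open scoped NNReal

/-! ### Fourier transform of a distribution function -/

/-- The difference of two unit steps, the one at `y` and the one at `0`, as a function of `x`. -/
noncomputable def stepDiff (x y : ℝ) : ℝ :=
  (Ici y).indicator 1 x - (Ici (0 : ℝ)).indicator 1 x

lemma stepDiff_eq (x y : ℝ) :
    stepDiff x y = (Ico y 0).indicator 1 x - (Ico 0 y).indicator 1 x := by
  simp only [stepDiff, indicator_apply, mem_Ici, mem_Ico, Pi.one_apply]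
  grind

lemma abs_stepDiff_eq (x y : ℝ) :
    |stepDiff x y| = (Ico y 0).indicator 1 x + (Ico 0 y).indicator 1 x := by
  rw [stepDiff_eq]
  simp only [indicator_apply, mem_Ico, Pi.one_apply]
  grind

lemma measurable_stepDiff : Measurable (fun p : ℝ × ℝ => stepDiff p.1 p.2) := by
  have h (p : ℝ × ℝ) : stepDiff p.1 p.2
      = {p : ℝ × ℝ | p.2 ≤ p.1}.indicator 1 p - {p : ℝ × ℝ | 0 ≤ p.1}.indicator 1 p := by
    simp [stepDiff, indicator_apply]
  simp_rw [h]
  exact (measurable_one.indicator (measurableSet_le measurable_snd measurable_fst)).sub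
    (measurable_one.indicator (measurableSet_le measurable_const measurable_fst))

lemma integral_abs_stepDiff (y : ℝ) : ∫ x, |stepDiff x y| = |y| := by
  simp_rw [abs_stepDiff_eq]
  rw [integral_add, integral_indicator_one measurableSet_Ico,
    integral_indicator_one measurableSet_Ico]
  · simp only [Real.volume_real_Ico]
    grind
  · exact (integrable_indicator_iff measurableSet_Ico).2
      (continuous_one.integrableOn_Icc.mono_set Ico_subset_Icc_self)
  · exact (integrable_indicator_iff measurableSet_Ico).2
      (continuous_one.integrableOn_Icc.mono_set Ico_subset_Icc_self)

lemma integrable_stepDiff_mul (y : ℝ) {g : ℝ → ℂ} (hg : Continuous g) :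
    Integrable (fun x => (stepDiff x y : ℂ) * g x) := by
  have h : (fun x => (stepDiff x y : ℂ) * g x)
      = fun x => (Ico y 0).indicator g x - (Ico 0 y).indicator g x := by
    ext x
    rw [stepDiff_eq]
    simp only [indicator_apply, Pi.one_apply]
    split_ifs <;> simp
  have hi (a b : ℝ) : Integrable ((Ico a b).indicator g) :=
    (integrable_indicator_iff measurableSet_Ico).2
      ((hg.integrableOn_Icc (a := a) (b := b)).mono_set Ico_subset_Icc_self)
  rw [h]
  exact (hi _ _).sub (hi _ _)

lemma integral_stepDiff_mul (y : ℝ) {g : ℝ → ℂ} (hg : Continuous g) :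
    ∫ x, (stepDiff x y : ℂ) * g x = -∫ x in (0 : ℝ)..y, g x := by
  have h : (fun x => (stepDiff x y : ℂ) * g x)
      = fun x => (Ico y 0).indicator g x - (Ico 0 y).indicator g x := by
    ext x
    rw [stepDiff_eq]
    simp only [indicator_apply, Pi.one_apply]
    split_ifs <;> simp
  have hi (a b : ℝ) : Integrable ((Ico a b).indicator g) :=
    (integrable_indicator_iff measurableSet_Ico).2
      ((hg.integrableOn_Icc (a := a) (b := b)).mono_set Ico_subset_Icc_self)
  rw [h, integral_sub (hi _ _) (hi _ _), integral_indicator measurableSet_Ico,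
    integral_indicator measurableSet_Ico, intervalIntegral,
    integral_Ico_eq_integral_Ioc, integral_Ico_eq_integral_Ioc]
  ring

lemma integral_exp_mul_I (s y : ℝ) (hs : s ≠ 0) :
    ∫ x in (0 : ℝ)..y, Complex.exp (s * x * Complex.I)
      = (Complex.exp (s * y * Complex.I) - 1) / (s * Complex.I) := by
  have hc : (s * Complex.I : ℂ) ≠ 0 := by simp [hs]
  have := integral_exp_mul_complex (a := 0) (b := y) hc
  simpa [mul_right_comm] using this

lemma integral_stepDiff_eq_cdf_sub {μ : Measure ℝ} [IsProbabilityMeasure μ] (x : ℝ) :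
    ∫ y, stepDiff x y ∂μ = cdf μ x - (Ici (0 : ℝ)).indicator 1 x := by
  have h : (fun y => stepDiff x y)
      = fun y => (Iic x).indicator 1 y - (Ici (0 : ℝ)).indicator 1 x := by
    ext y
    simp [stepDiff, indicator_apply]
  rw [h, integral_sub _ (integrable_const _), integral_indicator_one measurableSet_Iic,
    cdf_eq_real, integral_const]
  · simp
  · exact (integrable_const (1 : ℝ)).indicator measurableSet_Iic

lemma integrable_stepDiff_mul_exp_prod {μ : Measure ℝ} [IsProbabilityMeasure μ]
    (hμ : Integrable id μ) (s : ℝ) :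
    Integrable (fun p : ℝ × ℝ => (stepDiff p.1 p.2 : ℂ) * Complex.exp (s * p.1 * Complex.I))
      (volume.prod μ) := by
  have hn (x y : ℝ) :
      ‖(stepDiff x y : ℂ) * Complex.exp (s * x * Complex.I)‖ = |stepDiff x y| := by
    rw [norm_mul, ← Complex.ofReal_mul, Complex.norm_exp_ofReal_mul_I, mul_one, Complex.norm_real,
      Real.norm_eq_abs]
  rw [integrable_prod_iff']
  · refine ⟨ae_of_all _ fun y => ?_, ?_⟩
    · exact integrable_stepDiff_mul y (g := fun x => Complex.exp (s * x * Complex.I)) (by fun_prop)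
    · simp_rw [hn, integral_abs_stepDiff]
      exact hμ.abs
  · exact ((Complex.measurable_ofReal.comp measurable_stepDiff).mul
      (by fun_prop)).aestronglyMeasurable

lemma integrable_cdf_sub_step {μ : Measure ℝ} [IsProbabilityMeasure μ] (hμ : Integrable id μ) :
    Integrable (fun x => cdf μ x - (Ici (0 : ℝ)).indicator 1 x) := by
  have h := (integrable_stepDiff_mul_exp_prod hμ 0).re.integral_prod_left
  refine h.congr (ae_of_all _ fun x => ?_)
  simp [← integral_stepDiff_eq_cdf_sub]

/-- Integration by parts for a distribution function, in the form of Fubini's theorem: the unit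
step at `0` is subtracted to make the distribution function integrable. -/
lemma integral_cdf_sub_step_mul_exp {μ : Measure ℝ} [IsProbabilityMeasure μ]
    (hμ : Integrable id μ) {s : ℝ} (hs : s ≠ 0) :
    ∫ x, ((cdf μ x - (Ici (0 : ℝ)).indicator 1 x : ℝ) : ℂ) * Complex.exp (s * x * Complex.I)
      = -(charFun μ s - 1) / (s * Complex.I) := by
  have h1 (x : ℝ) :
      ((cdf μ x - (Ici (0 : ℝ)).indicator 1 x : ℝ) : ℂ) * Complex.exp (s * x * Complex.I)
        = ∫ y, (stepDiff x y : ℂ) * Complex.exp (s * x * Complex.I) ∂μ := by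
    rw [integral_mul_const, integral_complex_ofReal, integral_stepDiff_eq_cdf_sub]
  have h2 (y : ℝ) : ∫ x, (stepDiff x y : ℂ) * Complex.exp (s * x * Complex.I)
      = -((Complex.exp (s * y * Complex.I) - 1) / (s * Complex.I)) := by
    rw [integral_stepDiff_mul y (g := fun x => Complex.exp (s * x * Complex.I)) (by fun_prop),
      integral_exp_mul_I s y hs]
  have hint : Integrable (fun y : ℝ => Complex.exp (s * y * Complex.I)) μ := by
    refine Integrable.of_bound (C := 1) (by fun_prop) (ae_of_all _ fun y => ?_)
    rw [← Complex.ofReal_mul, Complex.norm_exp_ofReal_mul_I]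
  simp_rw [h1]
  rw [integral_integral_swap (integrable_stepDiff_mul_exp_prod hμ s)]
  simp_rw [h2]
  rw [integral_neg, integral_div, integral_sub hint (integrable_const _), charFun_apply_real]
  simp only [integral_const, probReal_univ, one_smul]
  ring

/-- A function that differs from a distribution function by a continuous function is bounded by the
`L¹` norm of its Fourier transform. Fourier inversion gives this at the points of continuity, which
are dense, and right-continuity gives the rest. -/
lemma abs_cdf_sub_le_integral_norm_fourier {μ : Measure ℝ} {G : ℝ → ℝ} (hG : Continuous G)
    (hi : Integrable (fun x => cdf μ x - G x))
    (hF : Integrable (𝓕 (fun x => ((cdf μ x - G x : ℝ) : ℂ)))) (x : ℝ) :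
    |cdf μ x - G x| ≤ ∫ w, ‖𝓕 (fun x => ((cdf μ x - G x : ℝ) : ℂ)) w‖ := by
  set h : ℝ → ℂ := fun x => ((cdf μ x - G x : ℝ) : ℂ) with hh
  have key (y : ℝ) (hy : ContinuousAt (cdf μ) y) : |cdf μ y - G y| ≤ ∫ w, ‖𝓕 h w‖ := by
    have hc : ContinuousAt h y :=
      Complex.continuous_ofReal.continuousAt.comp (hy.sub hG.continuousAt)
    have e := Integrable.fourierInv_fourier_eq (f := h) hi.ofReal hF hc
    have : |cdf μ y - G y| = ‖h y‖ := by
      rw [hh, Complex.norm_real, Real.norm_eq_abs]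
    rw [this, ← e, Real.fourierInv_eq]
    refine (norm_integral_le_integral_norm _).trans (le_of_eq ?_)
    simp [Circle.norm_smul]
  have hd : Dense {y | ContinuousAt (cdf μ) y} := by
    have := (monotone_cdf μ).countable_not_continuousAt.dense_compl ℝ
    simpa [compl_ofPred] using this
  have ht : Tendsto (fun y => |cdf μ y - G y|) (𝓝[>] x) (𝓝 |cdf μ x - G x|) := by
    have h1 : ContinuousWithinAt (cdf μ) (Ioi x) x :=
      ((cdf μ).right_continuous x).mono Ioi_subset_Ici_self
    exact (h1.sub hG.continuousWithinAt).abs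
  refine le_of_tendsto_of_frequently ht ?_
  rw [(nhdsGT_basis x).frequently_iff]
  intro b hb
  obtain ⟨y, hy, hxy⟩ := hd.exists_between hb
  exact ⟨y, hxy, key y hy⟩

/-! ### The Edgeworth approximation and its Fourier transform -/

/-- The density of `N(0, v)` times `(1 - x² / v) / v`, that is, minus its second derivative. -/
noncomputable def negSecondDerivGaussian (v : ℝ≥0) (x : ℝ) : ℝ :=
  (1 - x ^ 2 / v) / v * gaussianPDFReal 0 v x

/-- The first-order Edgeworth approximation to the distribution function of a centred law with
variance `v` and third cumulant `m`, without normalization. -/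
noncomputable def edgeworthCDF (v : ℝ≥0) (m x : ℝ) : ℝ :=
  cdf (gaussianReal 0 v) x + m / 6 * negSecondDerivGaussian v x

lemma edgeworthCDF_eq {v : ℝ≥0} (hv : v ≠ 0) (m x : ℝ) :
    edgeworthCDF v m x = stdNormalCDF (x / √v) +
      (1 - (x / √v) ^ 2) * stdNormalPDF (x / √v) / 6 * (m / √v ^ 3) := by
  have h0 : (0 : ℝ) < v := by positivity
  have hs : (0 : ℝ) < √v := Real.sqrt_pos.2 h0
  have hsq : √(v : ℝ) ^ 2 = v := Real.sq_sqrt h0.le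
  have hcdf : cdf (gaussianReal 0 v) x = stdNormalCDF (x / √v) := by
    have h := gaussianReal_map_div_const (μ := 0) (v := v) (√(v : ℝ))
    have e : v / NNReal.mk (√(v : ℝ) ^ 2) (sq_nonneg _) = 1 := by
      ext
      rw [NNReal.coe_div, NNReal.coe_mk, hsq, div_self h0.ne', NNReal.coe_one]
    rw [e, zero_div] at h
    rw [stdNormalCDF, cdf_eq_real, cdf_eq_real, ← h,
      map_measureReal_apply (by fun_prop) measurableSet_Iic]
    congr 1
    ext y
    simp [div_le_div_iff_of_pos_right hs]
  have hpdf : gaussianPDFReal 0 v x = stdNormalPDF (x / √v) / √v := by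
    simp only [stdNormalPDF, gaussianPDFReal, sub_zero, NNReal.coe_one, mul_one, div_pow, hsq]
    rw [Real.sqrt_mul (by positivity) (v : ℝ)]
    have : -x ^ 2 / (2 * (v : ℝ)) = -(x ^ 2 / v) / 2 := by field_simp
    rw [this]
    field_simp
  rw [edgeworthCDF, negSecondDerivGaussian, hcdf, hpdf, div_pow, hsq]
  have h3 : √(v : ℝ) ^ 3 = v * √v := by rw [pow_succ, hsq]
  rw [h3]
  field_simp

lemma continuous_cdf_gaussianReal {v : ℝ≥0} (hv : v ≠ 0) :
    Continuous (cdf (gaussianReal 0 v)) := by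
  have := nullSingletonClass_gaussianReal (μ := 0) hv
  rw [continuous_iff_continuousAt]
  intro x
  have hmono := monotone_cdf (gaussianReal 0 v)
  rw [hmono.continuousAt_iff_leftLim_eq_rightLim, StieltjesFunction.rightLim_eq]
  refine le_antisymm (hmono.leftLim_le le_rfl) ?_
  have h := (cdf (gaussianReal 0 v)).measure_singleton x
  rw [measure_cdf, measure_singleton] at h
  simpa using h.symm

lemma continuous_negSecondDerivGaussian (v : ℝ≥0) : Continuous (negSecondDerivGaussian v) := by
  unfold negSecondDerivGaussian gaussianPDFReal
  fun_prop

lemma continuous_edgeworthCDF {v : ℝ≥0} (hv : v ≠ 0) (m : ℝ) :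
    Continuous (edgeworthCDF v m) :=
  (continuous_cdf_gaussianReal hv).add
    (continuous_const.mul (continuous_negSecondDerivGaussian v))

lemma integrable_pow_gaussianReal (v : ℝ≥0) (n : ℕ) :
    Integrable (fun x : ℝ => x ^ n) (gaussianReal 0 v) := by
  have := (memLp_id_gaussianReal (μ := 0) (v := v) n).integrable_norm_pow'
  refine this.mono' (by fun_prop) (ae_of_all _ fun x => ?_)
  simp

lemma integrable_id_gaussianReal (v : ℝ≥0) : Integrable id (gaussianReal 0 v) := by
  exact (integrable_pow_gaussianReal v 1).congr (ae_of_all _ fun x => pow_one x)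

lemma integrable_negSecondDerivGaussian {v : ℝ≥0} (hv : v ≠ 0) :
    Integrable (negSecondDerivGaussian v) := by
  have h : Integrable (fun x : ℝ => (1 - x ^ 2 / v) / v) (gaussianReal 0 v) :=
    ((integrable_const 1).sub ((integrable_pow_gaussianReal v 2).div_const _)).div_const _
  rw [gaussianReal_of_var_ne_zero _ hv,
    integrable_withDensity_iff_integrable_smul' (measurable_gaussianPDF 0 v)
      (ae_of_all _ fun _ => gaussianPDF_lt_top)] at h
  refine h.congr (ae_of_all _ fun x => ?_)
  simp [negSecondDerivGaussian, toReal_gaussianPDF, mul_comm]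

/-- The second moment of a Gaussian law against a character is read off from the second derivative
of its characteristic function. -/
lemma integral_sq_mul_exp_gaussianReal (v : ℝ≥0) (s : ℝ) :
    ∫ x, ((x : ℂ) ^ 2) * Complex.exp (s * x * Complex.I) ∂(gaussianReal 0 v)
      = (v - v ^ 2 * s ^ 2) * Complex.exp (-(v * s ^ 2 / 2)) := by
  have h := iteratedDeriv_charFun (μ := gaussianReal 0 v) (n := 2) (t := s)
    (memLp_id_gaussianReal 2)
  have hφ : charFun (gaussianReal 0 v) = fun t : ℝ => Complex.exp (-(v * (t : ℂ) ^ 2 / 2)) := by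
    ext t
    rw [charFun_gaussianReal]
    simp
  have hd1 (t : ℝ) : HasDerivAt (fun t : ℝ => Complex.exp (-(v * (t : ℂ) ^ 2 / 2)))
      (-(v * t) * Complex.exp (-(v * (t : ℂ) ^ 2 / 2))) t := by
    have h1 : HasDerivAt (fun z : ℂ => Complex.exp (-(v * z ^ 2 / 2)))
      (Complex.exp (-(v * (t : ℂ) ^ 2 / 2)) * (-(v * (2 * t) / 2))) (t : ℂ) := by
      have := ((((hasDerivAt_id (t : ℂ)).pow 2).const_mul (v : ℂ)).div_const 2).neg.cexp
      simpa using this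
    convert h1.comp_ofReal using 1
    ring
  have hd2 (t : ℝ) : HasDerivAt
      (fun t : ℝ => -(v * (t : ℂ)) * Complex.exp (-(v * (t : ℂ) ^ 2 / 2)))
      ((v ^ 2 * t ^ 2 - v) * Complex.exp (-(v * (t : ℂ) ^ 2 / 2))) t := by
    have h1 : HasDerivAt (fun t : ℝ => -(v * (t : ℂ))) (-(v * 1)) t :=
      ((hasDerivAt_id (t : ℂ)).comp_ofReal.const_mul (v : ℂ)).neg
    exact (h1.mul (hd1 t)).congr_deriv (by ring)
  rw [iteratedDeriv_succ, iteratedDeriv_one, hφ, funext fun t => (hd1 t).deriv, (hd2 s).deriv,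
    Complex.I_sq] at h
  linear_combination h

lemma integral_negSecondDerivGaussian_mul_exp {v : ℝ≥0} (hv : v ≠ 0) (s : ℝ) :
    ∫ x, (negSecondDerivGaussian v x : ℂ) * Complex.exp (s * x * Complex.I)
      = s ^ 2 * Complex.exp (-(v * s ^ 2 / 2)) := by
  have h0 : (v : ℂ) ≠ 0 := by exact_mod_cast hv
  have h : ∫ x, (negSecondDerivGaussian v x : ℂ) * Complex.exp (s * x * Complex.I)
      = ∫ x, (1 / (v : ℂ)) * Complex.exp (s * x * Complex.I) -
          (1 / (v : ℂ) ^ 2) * ((x : ℂ) ^ 2 * Complex.exp (s * x * Complex.I))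
          ∂(gaussianReal 0 v) := by
    rw [integral_gaussianReal_eq_integral_smul hv]
    congr 1
    ext x
    simp only [negSecondDerivGaussian, Complex.real_smul]
    push_cast
    field_simp
  have hi1 : Integrable (fun x : ℝ => Complex.exp (s * x * Complex.I)) (gaussianReal 0 v) := by
    refine Integrable.of_bound (C := 1) (by fun_prop) (ae_of_all _ fun y => ?_)
    rw [← Complex.ofReal_mul, Complex.norm_exp_ofReal_mul_I]
  have hi2 : Integrable (fun x : ℝ => (x : ℂ) ^ 2 * Complex.exp (s * x * Complex.I))
      (gaussianReal 0 v) := by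
    refine (integrable_pow_gaussianReal v 2).mono' (by fun_prop) (ae_of_all _ fun y => ?_)
    rw [norm_mul, ← Complex.ofReal_mul, Complex.norm_exp_ofReal_mul_I]
    simp
  have hφ : ∫ x, Complex.exp (s * x * Complex.I) ∂(gaussianReal 0 v)
      = Complex.exp (-(v * s ^ 2 / 2)) := by
    rw [← charFun_apply_real, charFun_gaussianReal]
    simp
  rw [h, integral_sub (hi1.const_mul _) (hi2.const_mul _), integral_const_mul, integral_const_mul,
    hφ, integral_sq_mul_exp_gaussianReal]
  field_simp
  ring

section

variable {μ : Measure ℝ} [IsProbabilityMeasure μ] {v : ℝ≥0}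

lemma integrable_cdf_sub_edgeworthCDF (hμ : Integrable id μ) (hv : v ≠ 0) (m : ℝ) :
    Integrable (fun x => cdf μ x - edgeworthCDF v m x) := by
  have hγ := integrable_id_gaussianReal v
  refine (((integrable_cdf_sub_step hμ).sub (integrable_cdf_sub_step hγ)).sub
    ((integrable_negSecondDerivGaussian hv).const_mul (m / 6))).congr (ae_of_all _ fun x => ?_)
  simp [edgeworthCDF]
  ring

/-- The difference, at frequency `s`, of a characteristic function `φ` and the Fourier transform of
the Edgeworth approximation with variance `v` and third cumulant `m`. -/
noncomputable def edgeworthCharError (φ : ℂ) (v m s : ℝ) : ℂ :=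
  φ - Complex.exp (-(v * s ^ 2 / 2)) * (1 + m * (s * Complex.I) ^ 3 / 6)

lemma integral_cdf_sub_edgeworthCDF_mul_exp (hμ : Integrable id μ) (hv : v ≠ 0) (m : ℝ) {s : ℝ}
    (hs : s ≠ 0) :
    ∫ x, ((cdf μ x - edgeworthCDF v m x : ℝ) : ℂ) * Complex.exp (s * x * Complex.I)
      = -edgeworthCharError (charFun μ s) v m s / (s * Complex.I) := by
  have hγ := integrable_id_gaussianReal v
  have hmul {f : ℝ → ℝ} (hf : Integrable f) :
      Integrable (fun x => (f x : ℂ) * Complex.exp (s * x * Complex.I)) := by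
    refine hf.ofReal.mul_bdd (c := 1) (by fun_prop) (ae_of_all _ fun y => ?_)
    rw [← Complex.ofReal_mul, Complex.norm_exp_ofReal_mul_I]
  have h (x : ℝ) :
      ((cdf μ x - edgeworthCDF v m x : ℝ) : ℂ) * Complex.exp (s * x * Complex.I)
      = ((cdf μ x - (Ici (0 : ℝ)).indicator 1 x : ℝ) : ℂ) * Complex.exp (s * x * Complex.I)
        - ((cdf (gaussianReal 0 v) x - (Ici (0 : ℝ)).indicator 1 x : ℝ) : ℂ)
          * Complex.exp (s * x * Complex.I)
        - (m / 6) * ((negSecondDerivGaussian v x : ℂ) * Complex.exp (s * x * Complex.I)) := by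
    rw [edgeworthCDF]
    push_cast
    ring
  have hφ : charFun (gaussianReal 0 v) s = Complex.exp (-(v * s ^ 2 / 2)) := by
    rw [charFun_gaussianReal]
    simp
  simp_rw [h]
  rw [integral_sub
      (by exact (hmul (integrable_cdf_sub_step hμ)).sub (hmul (integrable_cdf_sub_step hγ)))
      ((hmul (integrable_negSecondDerivGaussian hv)).const_mul _),
    integral_sub (hmul (integrable_cdf_sub_step hμ)) (hmul (integrable_cdf_sub_step hγ)),
    integral_const_mul, integral_cdf_sub_step_mul_exp hμ hs, integral_cdf_sub_step_mul_exp hγ hs,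
    integral_negSecondDerivGaussian_mul_exp hv, hφ, edgeworthCharError]
  have hs' : (s : ℂ) ≠ 0 := by exact_mod_cast hs
  have hI3 : Complex.I ^ 3 = -Complex.I := Complex.I_pow_three
  field_simp
  rw [hI3]
  ring

/-- Smoothing-free Esseen inequality: a bound `B` for the weighted error of the characteristic
function controls the error of the distribution function uniformly. -/
lemma abs_cdf_sub_edgeworthCDF_le (hμ : Integrable id μ) (hv : v ≠ 0) (m : ℝ) {B : ℝ → ℝ}
    (hB : Integrable B)
    (h : ∀ s ≠ 0, ‖edgeworthCharError (charFun μ s) v m s‖ ≤ |s| * B s) (x : ℝ) :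
    |cdf μ x - edgeworthCDF v m x| ≤ ∫ s, B s := by
  set H : ℝ → ℂ := fun x => ((cdf μ x - edgeworthCDF v m x : ℝ) : ℂ) with hH
  have hi := integrable_cdf_sub_edgeworthCDF hμ hv m
  have hπ : (-2 * Real.pi) ≠ 0 := by simp [Real.pi_ne_zero]
  have hB' : Integrable (fun w => B (-2 * Real.pi * w)) := hB.comp_mul_left' hπ
  have hbound (w : ℝ) (hw : w ≠ 0) : ‖𝓕 H w‖ ≤ B (-2 * Real.pi * w) := by
    have hs : -2 * Real.pi * w ≠ 0 := mul_ne_zero hπ hw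
    have e : 𝓕 H w = ∫ x, H x * Complex.exp ((-2 * Real.pi * w : ℝ) * x * Complex.I) := by
      rw [Real.fourier_eq']
      congr 1
      ext x
      rw [smul_eq_mul, mul_comm]
      congr 2
      simp
      ring
    rw [e, integral_cdf_sub_edgeworthCDF_mul_exp hμ hv m hs, norm_div, norm_neg, norm_mul,
      Complex.norm_I, mul_one, Complex.norm_real, Real.norm_eq_abs,
      div_le_iff₀ (abs_pos.2 hs), mul_comm (B _)]
    exact h _ hs
  have hae : ∀ᵐ w : ℝ, ‖𝓕 H w‖ ≤ B (-2 * Real.pi * w) := by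
    filter_upwards [compl_mem_ae_iff.2 (measure_singleton (0 : ℝ))] with w hw
    exact hbound w hw
  have hcont : Continuous (𝓕 H) := VectorFourier.fourierIntegral_continuous
    Real.continuous_fourierChar (by fun_prop) hi.ofReal
  have hF : Integrable (𝓕 H) := hB'.mono' hcont.aestronglyMeasurable hae
  refine (abs_cdf_sub_le_integral_norm_fourier (continuous_edgeworthCDF hv m) hi hF x).trans ?_
  refine (integral_mono_ae hF.norm hB' hae).trans ?_
  rw [Measure.integral_comp_mul_left]
  have hB0 : 0 ≤ ∫ s, B s := by
    refine integral_nonneg_of_ae ?_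
    filter_upwards [compl_mem_ae_iff.2 (measure_singleton (0 : ℝ))] with s hs
    have hs' : 0 < |s| := abs_pos.2 hs
    exact nonneg_of_mul_nonneg_right ((norm_nonneg _).trans (h s hs)) hs'
  refine mul_le_of_le_one_left hB0 ?_
  rw [abs_inv, abs_mul, abs_of_pos Real.pi_pos]
  refine inv_le_one_of_one_le₀ ?_
  norm_num
  nlinarith [Real.pi_gt_three]

end

/-! ### Characteristic functions near the origin -/

/-- The exponent of the approximation `exp (-v s² / 2 + m (i s)³ / 6)` to a characteristic function
with variance `v` and third cumulant `m`. -/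
noncomputable def cubicExponent (v m s : ℝ) : ℂ :=
  -(v * s ^ 2 / 2) + m * (s * Complex.I) ^ 3 / 6

lemma cubicExponent_eq (v m s : ℝ) :
    cubicExponent v m s
      = ((-(v * s ^ 2 / 2) : ℝ) : ℂ) + ((-(m * s ^ 3 / 6) : ℝ) : ℂ) * Complex.I := by
  rw [cubicExponent, mul_pow, Complex.I_pow_three]
  push_cast
  ring

lemma norm_exp_cubicExponent (v m s : ℝ) :
    ‖Complex.exp (cubicExponent v m s)‖ = Real.exp (-(v * s ^ 2 / 2)) := by
  rw [cubicExponent_eq, Complex.norm_exp]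
  simp only [Complex.add_re, Complex.ofReal_re, Complex.re_ofReal_mul, Complex.I_re, mul_zero,
    add_zero]

lemma norm_exp_mul_I_sub_one_sub_le (θ : ℝ) :
    ‖Complex.exp (θ * Complex.I) - 1 - θ * Complex.I‖ ≤ 3 * θ ^ 2 := by
  have hn : ‖(θ * Complex.I : ℂ)‖ = |θ| := by simp
  rcases le_total |θ| 1 with h | h
  · refine (Complex.norm_exp_sub_one_sub_id_le (by rwa [hn])).trans ?_
    rw [hn, sq_abs]
    nlinarith [sq_nonneg θ]
  · refine (norm_sub_le _ _).trans ((add_le_add_left (norm_sub_le _ _) _).trans ?_)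
    rw [hn, Complex.norm_exp_ofReal_mul_I, norm_one]
    nlinarith [sq_abs θ]

lemma norm_pow_sub_pow_le {a b : ℂ} {r : ℝ} (ha : ‖a‖ ≤ r) (hb : ‖b‖ ≤ r) (n : ℕ) :
    ‖a ^ n - b ^ n‖ ≤ n * ‖a - b‖ * r ^ (n - 1) := by
  have hr : 0 ≤ r := (norm_nonneg a).trans ha
  rw [← (Commute.all a b).mul_geom_sum₂, norm_mul, mul_comm (n : ℝ), mul_assoc]
  gcongr
  refine (norm_sum_le _ _).trans ?_
  have : ∀ i ∈ Finset.range n, ‖a ^ i * b ^ (n - 1 - i)‖ ≤ r ^ (n - 1) := fun i hi => by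
    have hi' : i + (n - 1 - i) = n - 1 := by
      have := Finset.mem_range.1 hi
      omega
    rw [norm_mul, norm_pow, norm_pow]
    calc ‖a‖ ^ i * ‖b‖ ^ (n - 1 - i) ≤ r ^ i * r ^ (n - 1 - i) := by gcongr
      _ = r ^ (n - 1) := by rw [← pow_add, hi']
  simpa using Finset.sum_le_sum this

section

variable {ν : Measure ℝ} [IsProbabilityMeasure ν]

lemma integrable_pow_of_abs_le_one (hb : ∀ᵐ x ∂ν, |x| ≤ 1) (k : ℕ) :
    Integrable (fun x : ℝ => x ^ k) ν := by
  refine Integrable.of_bound (C := 1) (by fun_prop) ?_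
  filter_upwards [hb] with x hx
  rw [norm_pow, Real.norm_eq_abs]
  exact pow_le_one₀ (abs_nonneg x) hx

lemma abs_integral_pow_le_one (hb : ∀ᵐ x ∂ν, |x| ≤ 1) (k : ℕ) : |∫ x, x ^ k ∂ν| ≤ 1 := by
  have := norm_integral_le_of_norm_le_const (μ := ν) (f := fun x : ℝ => x ^ k) (C := 1) (by
    filter_upwards [hb] with x hx
    rw [norm_pow, Real.norm_eq_abs]
    exact pow_le_one₀ (abs_nonneg x) hx)
  simpa using this

lemma norm_charFun_sub_taylor_le (hb : ∀ᵐ x ∂ν, |x| ≤ 1) (h1 : ∫ x, x ∂ν = 0) {s : ℝ}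
    (hs : |s| ≤ 1) :
    ‖charFun ν s - (1 + cubicExponent (∫ x, x ^ 2 ∂ν) (∫ x, x ^ 3 ∂ν) s)‖ ≤ s ^ 4 := by
  have hp := integrable_pow_of_abs_le_one hb
  have hpc (k : ℕ) : Integrable (fun x : ℝ => (x : ℂ) ^ k) ν := by
    simpa using (hp k).ofReal (𝕜 := ℂ)
  have hT : ∫ x : ℝ, ∑ k ∈ Finset.range 4, (s * x * Complex.I) ^ k / (k.factorial : ℂ) ∂ν
      = 1 + cubicExponent (∫ x, x ^ 2 ∂ν) (∫ x, x ^ 3 ∂ν) s := by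
    have e (k : ℕ) (x : ℝ) : (s * x * Complex.I) ^ k / (k.factorial : ℂ)
        = ((s * Complex.I) ^ k / (k.factorial : ℂ)) * (x : ℂ) ^ k := by ring
    have hm (k : ℕ) : ∫ x : ℝ, (x : ℂ) ^ k ∂ν = ((∫ x, x ^ k ∂ν : ℝ) : ℂ) := by
      rw [← integral_complex_ofReal]
      simp
    simp_rw [e]
    rw [integral_finsetSum _ fun k _ => (hpc k).const_mul _]
    simp_rw [integral_const_mul, hm]
    simp [Finset.sum_range_succ, h1, cubicExponent, Nat.factorial, mul_pow]
    ring
  have hexp : Integrable (fun x : ℝ => Complex.exp (s * x * Complex.I)) ν := by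
    refine Integrable.of_bound (C := 1) (by fun_prop) (ae_of_all _ fun y => ?_)
    rw [← Complex.ofReal_mul, Complex.norm_exp_ofReal_mul_I]
  have hsum : Integrable
      (fun x : ℝ => ∑ k ∈ Finset.range 4, (s * x * Complex.I) ^ k / (k.factorial : ℂ)) ν := by
    refine integrable_finsetSum _ fun k _ => ?_
    refine ((hpc k).const_mul ((s * Complex.I) ^ k / (k.factorial : ℂ))).congr
      (ae_of_all _ fun x => ?_)
    ring
  rw [← hT, charFun_apply_real, ← integral_sub hexp hsum]
  have hbd : ∀ᵐ x : ℝ ∂ν, ‖Complex.exp (s * x * Complex.I)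
      - ∑ k ∈ Finset.range 4, (s * x * Complex.I) ^ k / (k.factorial : ℂ)‖ ≤ s ^ 4 := by
    filter_upwards [hb] with x hx
    have hn : ‖(s * x * Complex.I : ℂ)‖ = |s| * |x| := by simp
    have hle : |s| * |x| ≤ |s| := mul_le_of_le_one_right (abs_nonneg s) hx
    refine (Complex.exp_bound (by rw [hn]; exact hle.trans hs) (by norm_num)).trans ?_
    rw [hn]
    calc (|s| * |x|) ^ 4 * ((Nat.succ 4 : ℕ) * ((Nat.factorial 4 : ℕ) * (4 : ℕ) : ℝ)⁻¹)
        ≤ |s| ^ 4 * 1 := by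
          gcongr
          norm_num [Nat.factorial]
      _ = s ^ 4 := by rw [mul_one, Even.pow_abs (by decide)]
  simpa using norm_integral_le_of_norm_le_const hbd

lemma norm_cubicExponent_le {v m s : ℝ} (hv : |v| ≤ 1) (hm : |m| ≤ 1) (hs : |s| ≤ 1) :
    ‖cubicExponent v m s‖ ≤ s ^ 2 := by
  rw [cubicExponent_eq]
  refine (norm_add_le _ _).trans ?_
  rw [norm_mul, Complex.norm_I, mul_one, Complex.norm_real, Complex.norm_real, norm_neg, norm_neg,
    Real.norm_eq_abs, Real.norm_eq_abs, abs_div, abs_div, abs_mul, abs_mul, abs_pow, abs_pow,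
    sq_abs, pow_succ |s|, sq_abs]
  have h1 : |v| * s ^ 2 ≤ s ^ 2 := mul_le_of_le_one_left (sq_nonneg s) hv
  have h2 : |m| * (s ^ 2 * |s|) ≤ s ^ 2 :=
    (mul_le_of_le_one_left (by positivity) hm).trans (mul_le_of_le_one_right (sq_nonneg s) hs)
  norm_num
  linarith [sq_nonneg s]

/-- Both functions have the same Taylor polynomial of degree three at the origin. -/
lemma norm_charFun_sub_exp_cubicExponent_le (hb : ∀ᵐ x ∂ν, |x| ≤ 1) (h1 : ∫ x, x ∂ν = 0) {s : ℝ}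
    (hs : |s| ≤ 1) :
    ‖charFun ν s - Complex.exp (cubicExponent (∫ x, x ^ 2 ∂ν) (∫ x, x ^ 3 ∂ν) s)‖
      ≤ 2 * s ^ 4 := by
  set u := cubicExponent (∫ x, x ^ 2 ∂ν) (∫ x, x ^ 3 ∂ν) s
  have hu : ‖u‖ ≤ s ^ 2 :=
    norm_cubicExponent_le (abs_integral_pow_le_one hb 2) (abs_integral_pow_le_one hb 3) hs
  have hs2 : s ^ 2 ≤ 1 := (sq_le_one_iff_abs_le_one s).2 hs
  have hexp : ‖Complex.exp u - 1 - u‖ ≤ s ^ 4 := by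
    refine (Complex.norm_exp_sub_one_sub_id_le (hu.trans hs2)).trans ?_
    calc ‖u‖ ^ 2 ≤ (s ^ 2) ^ 2 := by gcongr
      _ = s ^ 4 := by ring
  have h := norm_charFun_sub_taylor_le hb h1 hs
  have e : charFun ν s - Complex.exp u
      = (charFun ν s - (1 + u)) - (Complex.exp u - 1 - u) := by ring
  rw [e]
  exact (norm_sub_le _ _).trans (by linarith)

/-- A Gaussian bound on the range in which the quartic remainder is absorbed by half of the quadratic
term. -/
lemma norm_charFun_le_exp (hb : ∀ᵐ x ∂ν, |x| ≤ 1) (h1 : ∫ x, x ∂ν = 0) {s : ℝ}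
    (hs : 12 * s ^ 2 ≤ ∫ x, x ^ 2 ∂ν) :
    ‖charFun ν s‖ ≤ Real.exp (-((∫ x, x ^ 2 ∂ν) * s ^ 2 / 4)) := by
  have hv1 := abs_integral_pow_le_one hb 2
  have h := norm_charFun_sub_exp_cubicExponent_le hb h1 (s := s)
  set v := ∫ x, x ^ 2 ∂ν
  rw [abs_le] at hv1
  have hs1 : |s| ≤ 1 := (sq_le_one_iff_abs_le_one s).1 (by nlinarith)
  have hs2 : s ^ 2 ≤ 1 := by nlinarith
  have hv0 : 0 ≤ v := le_trans (by positivity) hs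
  have h2 := norm_le_norm_add_norm_sub' (charFun ν s)
    (Complex.exp (cubicExponent v (∫ x, x ^ 3 ∂ν) s))
  rw [norm_exp_cubicExponent] at h2
  have hx : |-(v * s ^ 2 / 2)| ≤ 1 := by
    rw [abs_neg, abs_of_nonneg (by positivity)]
    nlinarith [sq_nonneg s]
  have h3 := (abs_le.1 (Real.norm_exp_sub_one_sub_id_le (x := -(v * s ^ 2 / 2)) hx)).2
  rw [Real.norm_eq_abs, sq_abs] at h3
  have h4 := Real.add_one_le_exp (-(v * s ^ 2 / 4))
  have h5 : v ^ 2 * s ^ 4 ≤ s ^ 4 :=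
    mul_le_of_le_one_left (by positivity) (pow_le_one₀ hv0 hv1.2)
  have h6 : 12 * s ^ 4 ≤ v * s ^ 2 := by nlinarith [sq_nonneg s]
  nlinarith [h hs1]

/-- The error of the Edgeworth approximation to the `n`-th power of a characteristic function, near
the origin. The power is compared with that of `exp (-v s² / 2 + m (i s)³ / 6)`, which is then
linearized in `m`. -/
lemma norm_edgeworthCharError_pow_le (hb : ∀ᵐ x ∂ν, |x| ≤ 1) (h1 : ∫ x, x ∂ν = 0) {s : ℝ}
    (hs : 12 * s ^ 2 ≤ ∫ x, x ^ 2 ∂ν) {n : ℕ} (hn : 2 ≤ n) :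
    ‖edgeworthCharError (charFun ν s ^ n) (n * ∫ x, x ^ 2 ∂ν) (n * ∫ x, x ^ 3 ∂ν) s‖
      ≤ (2 * n * s ^ 4 + n ^ 2 * s ^ 6) * Real.exp (-(n * (∫ x, x ^ 2 ∂ν) * s ^ 2 / 8)) := by
  have hv1 := abs_integral_pow_le_one hb 2
  have hm1 := abs_integral_pow_le_one hb 3
  have hφ := norm_charFun_le_exp hb h1 hs
  have hd := norm_charFun_sub_exp_cubicExponent_le hb h1 (s := s)
  set v := ∫ x, x ^ 2 ∂ν
  set m := ∫ x, x ^ 3 ∂ν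
  have hv0 : 0 ≤ v := le_trans (by positivity) hs
  have hvs : 0 ≤ v * s ^ 2 := by positivity
  have hs1 : |s| ≤ 1 := (sq_le_one_iff_abs_le_one s).1 (by nlinarith [(abs_le.1 hv1).2])
  set w := Complex.exp (cubicExponent v m s) with hw
  have hn' : (2 : ℝ) ≤ n := by exact_mod_cast hn
  have hwn : ‖w‖ ≤ Real.exp (-(v * s ^ 2 / 4)) := by
    rw [hw, norm_exp_cubicExponent]
    exact Real.exp_le_exp.2 (by linarith)
  -- the exponent `(n - 1) / 4` left by the telescoping sum is at least `n / 8`, as `2 ≤ n`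
  have hA : ‖charFun ν s ^ n - w ^ n‖
      ≤ 2 * n * s ^ 4 * Real.exp (-(n * v * s ^ 2 / 8)) := by
    refine (norm_pow_sub_pow_le hφ hwn n).trans ?_
    rw [← Real.exp_nat_mul]
    have : ((n - 1 : ℕ) : ℝ) * -(v * s ^ 2 / 4) ≤ -(n * v * s ^ 2 / 8) := by
      rw [Nat.cast_sub (by omega), Nat.cast_one]
      nlinarith
    calc (n : ℝ) * ‖charFun ν s - w‖ * Real.exp (((n - 1 : ℕ) : ℝ) * -(v * s ^ 2 / 4))
        ≤ n * (2 * s ^ 4) * Real.exp (-(n * v * s ^ 2 / 8)) := by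
          gcongr
          exact hd hs1
      _ = _ := by ring
  set θ : ℝ := -(n * m * s ^ 3 / 6) with hθ
  have hwpow : w ^ n = Complex.exp (-((n * v : ℝ) * s ^ 2 / 2)) * Complex.exp (θ * Complex.I) := by
    rw [hw, ← Complex.exp_nat_mul, ← Complex.exp_add, cubicExponent_eq]
    congr 1
    push_cast [hθ]
    ring
  have hlin : (1 : ℂ) + (n * m : ℝ) * (s * Complex.I) ^ 3 / 6 = 1 + θ * Complex.I := by
    rw [mul_pow, Complex.I_pow_three]
    push_cast [hθ]
    ring
  have hge : ‖Complex.exp (-((n * v : ℝ) * s ^ 2 / 2))‖ ≤ Real.exp (-(n * v * s ^ 2 / 8)) := by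
    have : (-((n * v : ℝ) * s ^ 2 / 2) : ℂ) = ((-(n * v * s ^ 2 / 2) : ℝ) : ℂ) := by
      push_cast
      ring
    rw [this, Complex.norm_exp_ofReal]
    refine Real.exp_le_exp.2 ?_
    have : 0 ≤ n * v * s ^ 2 := by positivity
    linarith
  have hθ2 : 3 * θ ^ 2 ≤ n ^ 2 * s ^ 6 := by
    have hm2 : m ^ 2 ≤ 1 := (sq_le_one_iff_abs_le_one m).2 hm1
    have : 0 ≤ (n : ℝ) ^ 2 * s ^ 6 := by positivity
    have e : 3 * θ ^ 2 = (n ^ 2 * s ^ 6) * m ^ 2 / 12 := by rw [hθ]; ring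
    rw [e]
    nlinarith
  have hB : ‖w ^ n - Complex.exp (-((n * v : ℝ) * s ^ 2 / 2)) * (1 + θ * Complex.I)‖
      ≤ n ^ 2 * s ^ 6 * Real.exp (-(n * v * s ^ 2 / 8)) := by
    rw [hwpow, ← mul_sub, norm_mul, mul_comm, ← sub_sub]
    gcongr
    exact (norm_exp_mul_I_sub_one_sub_le θ).trans hθ2
  rw [edgeworthCharError, hlin, add_mul]
  exact (norm_sub_le_norm_sub_add_norm_sub _ (w ^ n) _).trans (add_le_add hA hB)

end

/-! ### The Edgeworth expansion under a decay condition -/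

lemma integrable_abs_pow_mul_exp_neg_mul_sq (k : ℕ) {b : ℝ} (hb : 0 < b) :
    Integrable (fun s : ℝ => |s| ^ k * Real.exp (-(b * s ^ 2))) := by
  have h := (integrable_rpow_mul_exp_neg_mul_sq hb (s := k) (by
    have : (0 : ℝ) ≤ k := k.cast_nonneg
    linarith)).norm
  refine h.congr (ae_of_all _ fun s => ?_)
  simp

lemma integral_abs_pow_mul_exp_neg_mul_sq (k : ℕ) {b : ℝ} (hb : 0 < b) :
    ∫ s : ℝ, |s| ^ (2 * k + 1) * Real.exp (-(b * s ^ 2)) = k.factorial / b ^ (k + 1) := by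
  have h := integral_comp_abs (f := fun r : ℝ => r ^ (2 * k + 1) * Real.exp (-(b * r ^ 2)))
  simp only [sq_abs] at h
  have h2 := integral_rpow_mul_exp_neg_mul_rpow (p := 2) (q := (2 * k + 1 : ℕ)) two_pos
    (by push_cast; have : (0 : ℝ) ≤ k := k.cast_nonneg; linarith) hb
  have e : -(((2 * k + 1 : ℕ) : ℝ) + 1) / 2 = -((k + 1 : ℕ) : ℝ) := by
    push_cast
    ring
  have e' : (((2 * k + 1 : ℕ) : ℝ) + 1) / 2 = (k : ℝ) + 1 := by
    push_cast
    ring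
  rw [e, e', Real.Gamma_nat_eq_factorial, Real.rpow_neg hb.le, Real.rpow_natCast] at h2
  have h3 : ∫ r in Ioi (0 : ℝ), r ^ (2 * k + 1) * Real.exp (-(b * r ^ 2))
      = (b ^ (k + 1))⁻¹ * (1 / 2) * k.factorial := by
    rw [← h2]
    refine setIntegral_congr_fun measurableSet_Ioi fun r _ => ?_
    simp only [Real.rpow_natCast, Real.rpow_ofNat, neg_mul]
  rw [h, h3]
  field_simp

lemma tendsto_charFun_cocompact_of_decay {ν : Measure ℝ} {α C : ℝ} (hα : 0 < α)
    (hdecay : ∀ s, ‖charFun ν s‖ ≤ C * (1 + |s|) ^ (-α)) :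
    Tendsto (charFun ν) (cocompact ℝ) (𝓝 0) := by
  refine squeeze_zero_norm hdecay ?_
  rw [← mul_zero C]
  refine Tendsto.const_mul C ((tendsto_rpow_neg_atTop hα).comp ?_)
  exact tendsto_atTop_add_const_left _ _ (tendsto_norm_cocompact_atTop (E := ℝ))

section

variable {ν : Measure ℝ} [IsProbabilityMeasure ν]

/-- A characteristic function that is less than one away from the origin and vanishes at infinity is
bounded away from one outside each neighbourhood of the origin. -/
lemma exists_norm_charFun_le_of_le_abs (hlt : ∀ s ≠ 0, ‖charFun ν s‖ < 1)
    (h0 : Tendsto (charFun ν) (cocompact ℝ) (𝓝 0)) {δ : ℝ} (hδ : 0 < δ) :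
    ∃ ρ : ℝ, 1 / 2 ≤ ρ ∧ ρ < 1 ∧ ∀ s, δ ≤ |s| → ‖charFun ν s‖ ≤ ρ := by
  have hev : ∀ᶠ s in cocompact ℝ, ‖charFun ν s‖ < 1 / 2 := by
    have := h0.norm
    rw [norm_zero] at this
    exact this.eventually_lt_const (by norm_num)
  obtain ⟨t, ht, hts⟩ := mem_cocompact.1 hev
  have hc : IsCompact (t ∩ {s | δ ≤ |s|}) :=
    ht.inter_right (isClosed_le continuous_const continuous_abs)
  rcases (t ∩ {s | δ ≤ |s|}).eq_empty_or_nonempty with he | hne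
  · refine ⟨1 / 2, le_rfl, by norm_num, fun s hs => ?_⟩
    by_cases hst : s ∈ t
    · exact absurd (show s ∈ t ∩ {s | δ ≤ |s|} from ⟨hst, hs⟩) (by simp [he])
    · exact (hts hst).le
  · obtain ⟨s₀, hs₀, hmax⟩ := hc.exists_isMaxOn hne
      (continuous_charFun (μ := ν)).norm.continuousOn
    have hs₀' : s₀ ≠ 0 := by
      rintro rfl
      have : δ ≤ |(0 : ℝ)| := hs₀.2
      rw [abs_zero] at this
      linarith
    refine ⟨max (1 / 2) ‖charFun ν s₀‖, le_max_left _ _, max_lt (by norm_num) (hlt s₀ hs₀'),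
      fun s hs => ?_⟩
    by_cases hst : s ∈ t
    · exact (hmax (show s ∈ t ∩ {s | δ ≤ |s|} from ⟨hst, hs⟩)).trans (le_max_right _ _)
    · exact (hts hst).le.trans (le_max_left _ _)

/-- Away from the origin, the Fourier transform of the approximation is dominated by the bound that
holds near the origin, up to a constant, so that one Gaussian integral serves both ranges. -/
lemma norm_edgeworthCharError_le_of_le_abs {φ : ℂ} {n : ℕ} {v m s δ : ℝ} (hn : 1 ≤ n)
    (hv : 0 ≤ v) (hm : |m| ≤ 1) (hδ : 0 < δ) (hδ1 : δ ≤ 1) (hs : δ ≤ |s|) :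
    ‖edgeworthCharError φ (n * v) (n * m) s‖ ≤ ‖φ‖ +
      |s| * (2 / δ ^ 4 * ((n * |s| ^ 3 + n ^ 2 * |s| ^ 5) * Real.exp (-(n * v / 8 * s ^ 2)))) := by
  have hn' : (1 : ℝ) ≤ n := by exact_mod_cast hn
  have hvs : 0 ≤ n * v * s ^ 2 := by positivity
  have hexp : ‖Complex.exp (-((n * v : ℝ) * s ^ 2 / 2))‖ ≤ Real.exp (-(n * v / 8 * s ^ 2)) := by
    have : (-((n * v : ℝ) * s ^ 2 / 2) : ℂ) = ((-(n * v * s ^ 2 / 2) : ℝ) : ℂ) := by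
      push_cast
      ring
    rw [this, Complex.norm_exp_ofReal]
    exact Real.exp_le_exp.2 (by linarith)
  have hlin : ‖(1 : ℂ) + (n * m : ℝ) * (s * Complex.I) ^ 3 / 6‖ ≤ 1 + n * |s| ^ 3 := by
    refine (norm_add_le _ _).trans ?_
    simp only [norm_one, norm_div, norm_mul, norm_pow, Complex.norm_I, Complex.norm_real,
      Real.norm_eq_abs, mul_one, Complex.ofReal_mul, Complex.ofReal_natCast, Complex.norm_natCast,
      Complex.norm_ofNat]
    have h1 : (n : ℝ) * |m| * |s| ^ 3 ≤ n * |s| ^ 3 := by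
      have : (n : ℝ) * |m| ≤ n := mul_le_of_le_one_right (by positivity) hm
      gcongr
    have h2 : 0 ≤ (n : ℝ) * |s| ^ 3 := by positivity
    linarith
  have h4 : 1 ≤ |s| ^ 4 / δ ^ 4 := (one_le_div (by positivity)).2 (by gcongr)
  have h3 : 1 ≤ |s| ^ 3 / δ ^ 4 := by
    rw [one_le_div (by positivity)]
    calc δ ^ 4 ≤ δ ^ 3 := pow_le_pow_of_le_one hδ.le hδ1 (by norm_num)
      _ ≤ |s| ^ 3 := by gcongr
  have hpoly : 1 + n * |s| ^ 3 ≤ |s| * (2 / δ ^ 4 * (n * |s| ^ 3 + n ^ 2 * |s| ^ 5)) := by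
    have e : |s| * (2 / δ ^ 4 * (n * |s| ^ 3 + n ^ 2 * |s| ^ 5))
        = 2 * (n * (|s| ^ 4 / δ ^ 4)) + 2 * (n ^ 2 * |s| ^ 3 * (|s| ^ 3 / δ ^ 4)) := by ring
    have h5 : 1 ≤ n * (|s| ^ 4 / δ ^ 4) := one_le_mul_of_one_le_of_one_le hn' h4
    have h6 : n * |s| ^ 3 ≤ n ^ 2 * |s| ^ 3 * (|s| ^ 3 / δ ^ 4) := by
      have h7 : (n : ℝ) ≤ n ^ 2 := by nlinarith
      calc (n : ℝ) * |s| ^ 3 = n * |s| ^ 3 * 1 := by ring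
        _ ≤ n ^ 2 * |s| ^ 3 * (|s| ^ 3 / δ ^ 4) := by gcongr
    have h8 : 0 ≤ (n : ℝ) * |s| ^ 3 := by positivity
    rw [e]
    linarith
  refine (norm_sub_le _ _).trans (add_le_add_right ?_ _)
  rw [norm_mul, mul_comm]
  calc _ ≤ (|s| * (2 / δ ^ 4 * (n * |s| ^ 3 + n ^ 2 * |s| ^ 5)))
        * Real.exp (-(n * v / 8 * s ^ 2)) := by
        gcongr
        exact hlin.trans hpoly
    _ = _ := by ring

/-- The first-order Edgeworth expansion, with error `O(1 / n)`, for the `n`-fold convolution of a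
centred law on `[-1, 1]` whose characteristic function is less than one in absolute value away from
the origin and decays like a power at infinity. -/
theorem exists_abs_cdf_sub_edgeworthCDF_le (hb : ∀ᵐ x ∂ν, |x| ≤ 1) (h1 : ∫ x, x ∂ν = 0)
    (hv : 0 < ∫ x, x ^ 2 ∂ν) (hlt : ∀ s ≠ 0, ‖charFun ν s‖ < 1) {α C : ℝ} (hα : 0 < α)
    (hdecay : ∀ s, ‖charFun ν s‖ ≤ C * (1 + |s|) ^ (-α)) :
    ∃ K ρ : ℝ, 0 ≤ ρ ∧ ρ < 1 ∧ ∀ n : ℕ, 2 ≤ n → ∀ (μ : Measure ℝ) [IsProbabilityMeasure μ],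
      Integrable id μ → (∀ s, charFun μ s = charFun ν s ^ n) → ∀ x,
        |cdf μ x - edgeworthCDF (n * ∫ x, x ^ 2 ∂ν).toNNReal (n * ∫ x, x ^ 3 ∂ν) x|
          ≤ K * (1 / n + ρ ^ n) := by
  have hv1 := abs_integral_pow_le_one hb 2
  have hm1 := abs_integral_pow_le_one hb 3
  have hnear {s : ℝ} := norm_edgeworthCharError_pow_le hb h1 (s := s)
  set v := ∫ x, x ^ 2 ∂ν
  set m := ∫ x, x ^ 3 ∂ν
  -- `δ` is the range in which the Taylor bounds at the origin apply
  obtain ⟨δ, hδ, hδ2⟩ : ∃ δ : ℝ, 0 < δ ∧ 12 * δ ^ 2 = v :=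
    ⟨√(v / 12), by positivity, by rw [Real.sq_sqrt (by positivity)]; ring⟩
  have hδ1 : δ ≤ 1 := by nlinarith [(abs_le.1 hv1).2]
  obtain ⟨ρ, hρ, hρ1, hfar⟩ :=
    exists_norm_charFun_le_of_le_abs hlt (tendsto_charFun_cocompact_of_decay hα hdecay) hδ
  have hρ0 : 0 < ρ := by linarith
  have hC : 0 ≤ C := by
    have h := (norm_nonneg _).trans (hdecay 0)
    simpa using h
  set h : ℝ → ℝ := fun s => (1 + |s|) ^ (-(1 + α)) with hh
  have hhint : Integrable h := by
    refine integrable_one_add_norm (E := ℝ) ?_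
    simpa using hα
  have hh0 (s : ℝ) : 0 ≤ h s := by positivity
  have hJ : 0 ≤ ∫ s, h s := integral_nonneg hh0
  refine ⟨2 / δ ^ 4 * (64 / v ^ 2 + 1024 / v ^ 3) + 2 * C * (1 + 1 / δ) * ∫ s, h s, ρ, hρ0.le,
    hρ1, fun n hn μ _ hμ hμν x => ?_⟩
  have hn0 : (0 : ℝ) < n := by
    have : (2 : ℝ) ≤ n := by exact_mod_cast hn
    linarith
  have hb8 : 0 < n * v / 8 := by positivity
  set B : ℝ → ℝ := fun s =>
    2 / δ ^ 4 * ((n * |s| ^ 3 + n ^ 2 * |s| ^ 5) * Real.exp (-(n * v / 8 * s ^ 2)))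
      + 2 * C * (1 + 1 / δ) * ρ ^ n * h s with hB
  have hi3 := integrable_abs_pow_mul_exp_neg_mul_sq 3 hb8
  have hi5 := integrable_abs_pow_mul_exp_neg_mul_sq 5 hb8
  have hsum : Integrable (fun s : ℝ =>
      (n * |s| ^ 3 + n ^ 2 * |s| ^ 5) * Real.exp (-(n * v / 8 * s ^ 2))) := by
    refine ((hi3.const_mul (n : ℝ)).add (hi5.const_mul ((n : ℝ) ^ 2))).congr
      (ae_of_all _ fun s => ?_)
    simp only [Pi.add_apply]
    ring
  have hsumval : ∫ s : ℝ, (n * |s| ^ 3 + n ^ 2 * |s| ^ 5) * Real.exp (-(n * v / 8 * s ^ 2))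
      = (64 / v ^ 2 + 1024 / v ^ 3) * (1 / n) := by
    have e (s : ℝ) : (n * |s| ^ 3 + n ^ 2 * |s| ^ 5) * Real.exp (-(n * v / 8 * s ^ 2))
        = n * (|s| ^ 3 * Real.exp (-(n * v / 8 * s ^ 2)))
          + n ^ 2 * (|s| ^ 5 * Real.exp (-(n * v / 8 * s ^ 2))) := by ring
    simp_rw [e]
    rw [integral_add (hi3.const_mul _) (hi5.const_mul _), integral_const_mul, integral_const_mul,
      integral_abs_pow_mul_exp_neg_mul_sq 1 hb8, integral_abs_pow_mul_exp_neg_mul_sq 2 hb8]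
    simp only [Nat.factorial]
    field_simp
    norm_num
    ring
  have hBint : Integrable B := (hsum.const_mul _).add (hhint.const_mul _)
  have hBval : ∫ s, B s = 2 / δ ^ 4 * ((64 / v ^ 2 + 1024 / v ^ 3) * (1 / n))
      + 2 * C * (1 + 1 / δ) * ρ ^ n * ∫ s, h s := by
    rw [hB, integral_add (hsum.const_mul _) (hhint.const_mul _), integral_const_mul,
      integral_const_mul, hsumval]
  have hV : (n * v).toNNReal ≠ 0 := (Real.toNNReal_pos.2 (by positivity)).ne'
  have hVc : (((n * v).toNNReal : ℝ≥0) : ℝ) = n * v := Real.coe_toNNReal _ (by positivity)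
  have hbd : ∀ s ≠ 0,
      ‖edgeworthCharError (charFun μ s) (n * v).toNNReal (n * m) s‖ ≤ |s| * B s := by
    intro s hs
    rw [hVc, hμν]
    have hrest : 0 ≤ 2 * C * (1 + 1 / δ) * ρ ^ n * h s := by
      have := hh0 s
      positivity
    rcases le_total |s| δ with hsd | hsd
    · have hs12 : 12 * s ^ 2 ≤ v := by
        rw [← hδ2, ← sq_abs s]
        gcongr
      refine (hnear hs12 hn).trans ?_
      have e : n * v * s ^ 2 / 8 = n * v / 8 * s ^ 2 := by ring
      rw [e]
      have h2 : 2 ≤ 2 / δ ^ 4 := by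
        rw [le_div_iff₀ (by positivity)]
        have := pow_le_one₀ (n := 4) hδ.le hδ1
        linarith
      have e4 : s ^ 4 = |s| * |s| ^ 3 := by
        rw [← pow_succ', Even.pow_abs (by decide)]
      have e6 : s ^ 6 = |s| * |s| ^ 5 := by
        rw [← pow_succ', Even.pow_abs (by decide)]
      calc (2 * n * s ^ 4 + n ^ 2 * s ^ 6) * Real.exp (-(n * v / 8 * s ^ 2))
          ≤ |s| * (2 * ((n * |s| ^ 3 + n ^ 2 * |s| ^ 5) * Real.exp (-(n * v / 8 * s ^ 2)))) := by
            rw [e4, e6]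
            have : 0 ≤ (n : ℝ) ^ 2 * (|s| * |s| ^ 5) * Real.exp (-(n * v / 8 * s ^ 2)) := by
              positivity
            linarith
        _ ≤ |s| * B s := by
            refine mul_le_mul_of_nonneg_left ?_ (abs_nonneg s)
            refine le_add_of_le_of_nonneg ?_ hrest
            gcongr
    · refine (norm_edgeworthCharError_le_of_le_abs (by omega) hv.le hm1 hδ hδ1 hsd).trans ?_
      rw [hB, mul_add, add_comm]
      refine add_le_add_right ?_ _
      have hpow : ‖charFun ν s ^ n‖ ≤ (2 * ρ ^ n) * (C * (1 + |s|) ^ (-α)) := by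
        obtain ⟨k, rfl⟩ : ∃ k, n = k + 1 := ⟨n - 1, by omega⟩
        rw [norm_pow, pow_succ]
        -- one factor is spent on the decay; `1 / 2 ≤ ρ` restores the exponent of `ρ`
        have h2 : ρ ^ k ≤ 2 * ρ ^ (k + 1) := by
          rw [pow_succ]
          nlinarith [pow_pos hρ0 k]
        calc ‖charFun ν s‖ ^ k * ‖charFun ν s‖ ≤ ρ ^ k * (C * (1 + |s|) ^ (-α)) := by
              gcongr
              · exact hfar s hsd
              · exact hdecay s
          _ ≤ _ := by gcongr
      have hpos : 0 < 1 + |s| := by positivity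
      have hsplit : (1 + |s|) ^ (-α) = (1 + |s|) * h s := by
        simp only [hh]
        rw [neg_add, Real.rpow_add hpos, Real.rpow_neg_one]
        field_simp
      have hone : 1 + |s| ≤ (1 + 1 / δ) * |s| := by
        have : 1 ≤ 1 / δ * |s| := by
          rw [one_div_mul_eq_div, one_le_div hδ]
          exact hsd
        linarith
      refine hpow.trans ?_
      rw [hsplit]
      calc 2 * ρ ^ n * (C * ((1 + |s|) * h s))
          ≤ 2 * ρ ^ n * (C * (((1 + 1 / δ) * |s|) * h s)) := by
            have := hh0 s
            gcongr
        _ = _ := by ring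
  refine (abs_cdf_sub_edgeworthCDF_le hμ hV (n * m) hBint hbd x).trans ?_
  rw [hBval]
  have hA : 0 ≤ 2 / δ ^ 4 * (64 / v ^ 2 + 1024 / v ^ 3) := by positivity
  have hD : 0 ≤ 2 * C * (1 + 1 / δ) * ∫ s, h s := by positivity
  have hn1 : (0 : ℝ) ≤ 1 / n := by positivity
  have hρn : 0 ≤ ρ ^ n := by positivity
  nlinarith [mul_nonneg hA hρn, mul_nonneg hD hn1]

end

/-! ### The characteristic function of a power of a uniform variable -/

section

variable {q : ℝ}

lemma continuous_exp_mul_rpow (hq : 0 < q) (s : ℝ) :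
    Continuous (fun z : ℝ => Complex.exp (s * (z ^ q : ℝ) * Complex.I)) := by
  have := Real.continuous_rpow_const hq.le
  fun_prop

lemma hasDerivAt_exp_mul_rpow (q s : ℝ) {z : ℝ} (hz : 0 < z) :
    HasDerivAt (fun z : ℝ => Complex.exp (s * (z ^ q : ℝ) * Complex.I))
      (s * q * (z ^ (q - 1) : ℝ) * Complex.I * Complex.exp (s * (z ^ q : ℝ) * Complex.I)) z := by
  have h1 := (Real.hasDerivAt_rpow_const (p := q) (Or.inl hz.ne')).ofReal_comp
  have h2 := ((h1.const_mul (s : ℂ)).mul_const Complex.I).cexp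
  refine h2.congr_deriv ?_
  push_cast
  ring

/-- Integration by parts away from the origin, where the phase `z ^ q` may degenerate. -/
lemma norm_integral_exp_mul_rpow_le_of_cutoff (hq : 0 < q) {s a : ℝ} (hs : s ≠ 0) (ha : 0 < a)
    (ha1 : a ≤ 1) :
    ‖∫ z in (0 : ℝ)..1, Complex.exp (s * (z ^ q : ℝ) * Complex.I)‖
      ≤ a + (2 + |1 - q|) / q * (a ^ (-q) / |s|) := by
  set e : ℝ → ℂ := fun z => Complex.exp (s * (z ^ q : ℝ) * Complex.I) with he
  have hec : Continuous e := continuous_exp_mul_rpow hq s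
  have hen (z : ℝ) : ‖e z‖ = 1 := by
    rw [he]
    dsimp only
    rw [← Complex.ofReal_mul, Complex.norm_exp_ofReal_mul_I]
  have hpos {z : ℝ} (hz : z ∈ uIcc a 1) : 0 < z := by
    rw [uIcc_of_le ha1] at hz
    exact ha.trans_le hz.1
  have haq : 1 ≤ a ^ (-q) := Real.one_le_rpow_of_pos_of_le_one_of_nonpos ha ha1 (by linarith)
  have hrp (p : ℝ) : ContinuousOn (fun z : ℝ => z ^ p) (uIcc a 1) :=
    ContinuousOn.rpow_const continuousOn_id fun z hz => Or.inl (hpos hz).ne'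
  have hrpc (p : ℝ) : ContinuousOn (fun z : ℝ => ((z ^ p : ℝ) : ℂ)) (uIcc a 1) :=
    Complex.continuous_ofReal.comp_continuousOn (hrp p)
  -- the integrand is `u v'` with `u = c z ^ (1 - q)` and `v = e`
  set c : ℂ := 1 / (s * q * Complex.I) with hc
  have hs' : (s : ℂ) ≠ 0 := by exact_mod_cast hs
  have hq' : (q : ℂ) ≠ 0 := by exact_mod_cast hq.ne'
  have hcn : ‖c‖ = 1 / (q * |s|) := by
    rw [hc]
    simp [abs_of_pos hq, mul_comm]
  have hparts := intervalIntegral.integral_mul_deriv_eq_deriv_mul (a := a) (b := 1)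
    (u := fun z : ℝ => c * ((z ^ (1 - q) : ℝ) : ℂ))
    (u' := fun z : ℝ => c * (((1 - q) * z ^ (-q) : ℝ) : ℂ)) (v := e)
    (v' := fun z : ℝ => s * q * (z ^ (q - 1) : ℝ) * Complex.I * e z)
    (fun z hz => by
      have h1 := (Real.hasDerivAt_rpow_const (p := 1 - q) (Or.inl (hpos hz).ne')).ofReal_comp
      refine (h1.const_mul c).congr_deriv ?_
      rw [show 1 - q - 1 = -q by ring])
    (fun z hz => hasDerivAt_exp_mul_rpow q s (hpos hz))
    (ContinuousOn.intervalIntegrable (by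
      refine continuousOn_const.mul ?_
      simp only [Complex.ofReal_mul]
      exact continuousOn_const.mul (hrpc (-q))))
    (ContinuousOn.intervalIntegrable
      (((continuousOn_const.mul (hrpc (q - 1))).mul continuousOn_const).mul hec.continuousOn))
  have hcongr : ∫ z in a..1, c * ((z ^ (1 - q) : ℝ) : ℂ)
        * (s * q * (z ^ (q - 1) : ℝ) * Complex.I * e z) = ∫ z in a..1, e z := by
    refine intervalIntegral.integral_congr fun z hz => ?_
    have h1 : z ^ (1 - q) * z ^ (q - 1) = 1 := by
      rw [← Real.rpow_add (hpos hz)]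
      simp
    have h2 : ((z ^ (1 - q) : ℝ) : ℂ) * ((z ^ (q - 1) : ℝ) : ℂ) = 1 := by exact_mod_cast h1
    have h3 : c * (s * q * Complex.I) = 1 := by
      rw [hc]
      field_simp
    calc _ = (c * (s * q * Complex.I)) * (((z ^ (1 - q) : ℝ) : ℂ) * ((z ^ (q - 1) : ℝ) : ℂ))
          * e z := by ring
      _ = e z := by rw [h2, h3, one_mul, one_mul]
  rw [hcongr] at hparts
  have hint : ‖∫ z in a..1, c * (((1 - q) * z ^ (-q) : ℝ) : ℂ) * e z‖
      ≤ 1 / (q * |s|) * (|1 - q| * a ^ (-q)) := by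
    have h := intervalIntegral.norm_integral_le_of_norm_le_const (a := a) (b := 1)
      (f := fun z => c * (((1 - q) * z ^ (-q) : ℝ) : ℂ) * e z)
      (C := 1 / (q * |s|) * (|1 - q| * a ^ (-q))) fun z hz => by
        rw [uIoc_of_le ha1] at hz
        have hz0 : 0 < z := ha.trans hz.1
        rw [norm_mul, norm_mul, hen, mul_one, hcn, Complex.norm_real, Real.norm_eq_abs, abs_mul,
          abs_of_pos (Real.rpow_pos_of_pos hz0 _)]
        have : z ^ (-q) ≤ a ^ (-q) :=
          Real.rpow_le_rpow_of_nonpos ha hz.1.le (by linarith)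
        gcongr
    refine h.trans (mul_le_of_le_one_right (by positivity) ?_)
    rw [abs_of_nonneg (by linarith)]
    linarith
  have hleft : ‖∫ z in (0 : ℝ)..a, e z‖ ≤ a := by
    have := intervalIntegral.norm_integral_le_of_norm_le_const (a := 0) (b := a) (f := e) (C := 1)
      fun z _ => (hen z).le
    simpa [abs_of_pos ha] using this
  have hright : ‖∫ z in a..1, e z‖ ≤ (2 + |1 - q|) / q * (a ^ (-q) / |s|) := by
    rw [hparts]
    have haa : a ^ (1 - q) ≤ a ^ (-q) :=
      Real.rpow_le_rpow_of_exponent_ge ha ha1 (by linarith)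
    have hb1 : ‖c * (((1 : ℝ) ^ (1 - q) : ℝ) : ℂ) * e 1‖ ≤ 1 / (q * |s|) * a ^ (-q) := by
      rw [norm_mul, norm_mul, hen, hcn, Real.one_rpow]
      simp only [Complex.ofReal_one, norm_one, mul_one]
      exact le_mul_of_one_le_right (by positivity) haq
    have hb2 : ‖c * ((a ^ (1 - q) : ℝ) : ℂ) * e a‖ ≤ 1 / (q * |s|) * a ^ (-q) := by
      rw [norm_mul, norm_mul, hen, hcn, mul_one, Complex.norm_real, Real.norm_eq_abs,
        abs_of_pos (Real.rpow_pos_of_pos ha _)]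
      gcongr
    calc _ ≤ 1 / (q * |s|) * a ^ (-q) + 1 / (q * |s|) * a ^ (-q)
          + 1 / (q * |s|) * (|1 - q| * a ^ (-q)) :=
          (norm_sub_le _ _).trans
            (add_le_add ((norm_sub_le _ _).trans (add_le_add hb1 hb2)) hint)
      _ = _ := by
        have : |s| ≠ 0 := abs_ne_zero.2 hs
        field_simp
        ring
  rw [← intervalIntegral.integral_add_adjacent_intervals (hec.intervalIntegrable 0 a)
    (hec.intervalIntegrable a 1)]
  exact (norm_add_le _ _).trans (add_le_add hleft hright)

/-- Polynomial decay, from the choice of the cutoff that balances the two terms. -/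
lemma norm_integral_exp_mul_rpow_le (hq : 0 < q) (s : ℝ) :
    ‖∫ z in (0 : ℝ)..1, Complex.exp (s * (z ^ q : ℝ) * Complex.I)‖
      ≤ (2 + 2 * ((2 + |1 - q|) / q)) * (1 + |s|) ^ (-(1 / (q + 1))) := by
  have hpos : 0 < 1 + |s| := by positivity
  have hD : 0 ≤ (2 + |1 - q|) / q := by positivity
  set A := (1 + |s|) ^ (-(1 / (q + 1))) with hA
  have hA0 : 0 < A := Real.rpow_pos_of_pos hpos _
  have hα : 1 / (q + 1) ≤ 1 := by
    rw [div_le_one (by linarith)]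
    linarith
  have hα0 : 0 < 1 / (q + 1) := by positivity
  rcases le_total |s| 1 with hs | hs
  · have h1 : ‖∫ z in (0 : ℝ)..1, Complex.exp (s * (z ^ q : ℝ) * Complex.I)‖ ≤ 1 := by
      have := intervalIntegral.norm_integral_le_of_norm_le_const (a := 0) (b := 1) (C := 1)
        (f := fun z : ℝ => Complex.exp (s * (z ^ q : ℝ) * Complex.I)) fun z _ => by
          rw [← Complex.ofReal_mul, Complex.norm_exp_ofReal_mul_I]
      simpa using this
    have h2 : 1 / 2 ≤ A := by
      calc (1 / 2 : ℝ) = 2 ^ (-1 : ℝ) := by rw [Real.rpow_neg_one]; norm_num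
        _ ≤ (1 + |s|) ^ (-1 : ℝ) :=
          Real.rpow_le_rpow_of_nonpos hpos (by linarith) (by norm_num)
        _ ≤ A := Real.rpow_le_rpow_of_exponent_le (by linarith [abs_nonneg s]) (by linarith)
    nlinarith
  · have hs0 : s ≠ 0 := by
      rintro rfl
      rw [abs_zero] at hs
      linarith
    have hA1 : A ≤ 1 := Real.rpow_le_one_of_one_le_of_nonpos (by linarith) (by linarith)
    refine (norm_integral_exp_mul_rpow_le_of_cutoff hq hs0 hA0 hA1).trans ?_
    have h1 : A ^ (-q) = A * (1 + |s|) := by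
      rw [hA, ← Real.rpow_mul hpos.le]
      nth_rewrite 3 [← Real.rpow_one (1 + |s|)]
      rw [← Real.rpow_add hpos]
      congr 1
      field_simp
      ring
    have h2 : A ^ (-q) / |s| ≤ 2 * A := by
      rw [h1, div_le_iff₀ (by linarith)]
      nlinarith
    have h3 : (2 + |1 - q|) / q * (A ^ (-q) / |s|) ≤ (2 + |1 - q|) / q * (2 * A) := by gcongr
    linarith

/-- Equality in the triangle inequality would force the phase to be constant. -/
lemma norm_integral_exp_mul_rpow_lt_one (hq : 0 < q) {s : ℝ} (hs : s ≠ 0) :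
    ‖∫ z in (0 : ℝ)..1, Complex.exp (s * (z ^ q : ℝ) * Complex.I)‖ < 1 := by
  set e : ℝ → ℂ := fun z => Complex.exp (s * (z ^ q : ℝ) * Complex.I) with he
  have hec : Continuous e := continuous_exp_mul_rpow hq s
  have hen (z : ℝ) : ‖e z‖ = 1 := by
    rw [he]
    dsimp only
    rw [← Complex.ofReal_mul, Complex.norm_exp_ofReal_mul_I]
  rw [intervalIntegral.integral_of_le zero_le_one, integral_Ioc_eq_integral_Ioo]
  rcases ae_eq_const_or_norm_setIntegral_lt_of_norm_le_const (μ := volume) (t := Ioo (0 : ℝ) 1)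
    (f := e) (C := 1) (by simp) (ae_of_all _ fun z => (hen z).le) with h | h
  · exfalso
    have heq := Measure.eqOn_open_of_ae_eq h isOpen_Ioo hec.continuousOn continuousOn_const
    have hmem : Ioo (0 : ℝ) 1 ∈ 𝓝 (1 / 2 : ℝ) := isOpen_Ioo.mem_nhds (by norm_num)
    have hd := hasDerivAt_exp_mul_rpow q s (z := 1 / 2) (by norm_num)
    have hd0 : HasDerivAt e 0 (1 / 2) :=
      (hasDerivAt_const (1 / 2 : ℝ) (⨍ x in Ioo (0 : ℝ) 1, e x)).congr_of_eventuallyEq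
        (heq.eventuallyEq_of_mem hmem)
    have := hd.unique hd0
    have hhalf : (0 : ℝ) < (1 / 2 : ℝ) ^ (q - 1) := Real.rpow_pos_of_pos (by norm_num) _
    simp only [mul_eq_zero, Complex.ofReal_eq_zero, Complex.I_ne_zero, Complex.exp_ne_zero, hs,
      hq.ne', hhalf.ne', or_self] at this
  · simpa using h

end

/-! ### Moments of a power of a uniform variable -/

lemma cond_volume_Icc_zero_one :
    cond (volume : Measure ℝ) (Icc 0 1) = volume.restrict (Icc (0 : ℝ) 1) := by
  simp [ProbabilityTheory.cond]

instance isProbabilityMeasure_restrict_Icc_zero_one :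
    IsProbabilityMeasure (volume.restrict (Icc (0 : ℝ) 1)) :=
  ⟨by simp⟩

lemma isUniform_id_Icc :
    pdf.IsUniform (id : ℝ → ℝ) (Icc (0 : ℝ) 1) (volume.restrict (Icc (0 : ℝ) 1)) volume := by
  rw [pdf.IsUniform, Measure.map_id, cond_volume_Icc_zero_one]

section

variable {q : ℝ}

lemma integrable_rpow_pow_restrict (hq : 0 < q) (k : ℕ) :
    Integrable (fun z : ℝ => (z ^ q) ^ k) (volume.restrict (Icc (0 : ℝ) 1)) :=
  ((Real.continuous_rpow_const hq.le).pow k).integrableOn_Icc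

lemma integral_rpow_pow_restrict (hq : 0 < q) (k : ℕ) :
    ∫ z in Icc (0 : ℝ) 1, (z ^ q) ^ k = 1 / (k * q + 1) := by
  have hk : (0 : ℝ) ≤ q * k := by positivity
  have h : ∫ z in Icc (0 : ℝ) 1, (z ^ q) ^ k = ∫ z in Icc (0 : ℝ) 1, z ^ (q * k) := by
    refine setIntegral_congr_fun measurableSet_Icc fun z hz => ?_
    simp only [Real.rpow_mul hz.1, Real.rpow_natCast]
  rw [h, integral_Icc_eq_integral_Ioc, ← intervalIntegral.integral_of_le zero_le_one,
    integral_rpow (Or.inl (by linarith)), Real.one_rpow, Real.zero_rpow (by linarith), sub_zero,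
    mul_comm]

lemma integral_rpow_restrict (hq : 0 < q) :
    ∫ z in Icc (0 : ℝ) 1, z ^ q = 1 / (q + 1) := by
  simpa using integral_rpow_pow_restrict hq 1

lemma integral_centered_rpow_restrict (hq : 0 < q) :
    ∫ z in Icc (0 : ℝ) 1, (z ^ q - 1 / (q + 1)) = 0 := by
  have h1 := (integrable_rpow_pow_restrict hq 1)
  simp only [pow_one] at h1
  rw [integral_sub h1 (integrable_const _), integral_rpow_restrict hq]
  simp

lemma integral_centered_rpow_sq_restrict (hq : 0 < q) :
    ∫ z in Icc (0 : ℝ) 1, (z ^ q - 1 / (q + 1)) ^ 2 = q ^ 2 / ((2 * q + 1) * (q + 1) ^ 2) := by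
  have hi := integrable_rpow_pow_restrict hq
  have e (z : ℝ) : (z ^ q - 1 / (q + 1)) ^ 2
      = ((z ^ q) ^ 2 - 2 * (1 / (q + 1)) * (z ^ q) ^ 1) + (1 / (q + 1)) ^ 2 := by ring
  simp_rw [e]
  rw [integral_add (by exact (hi 2).sub ((hi 1).const_mul _)) (integrable_const _),
    integral_sub (hi 2) ((hi 1).const_mul _), integral_const_mul, integral_rpow_pow_restrict hq,
    integral_rpow_pow_restrict hq]
  simp only [integral_const, probReal_univ, one_smul]
  push_cast
  field_simp
  ring

lemma integral_centered_rpow_cube_restrict (hq : 0 < q) :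
    ∫ z in Icc (0 : ℝ) 1, (z ^ q - 1 / (q + 1)) ^ 3
      = 2 * q ^ 3 * (q - 1) / ((3 * q + 1) * (2 * q + 1) * (q + 1) ^ 3) := by
  have hi := integrable_rpow_pow_restrict hq
  have e (z : ℝ) : (z ^ q - 1 / (q + 1)) ^ 3
      = (((z ^ q) ^ 3 - 3 * (1 / (q + 1)) * (z ^ q) ^ 2) + 3 * (1 / (q + 1)) ^ 2 * (z ^ q) ^ 1)
        - (1 / (q + 1)) ^ 3 := by ring
  simp_rw [e]
  rw [integral_sub
      (by exact ((hi 3).sub ((hi 2).const_mul _)).add ((hi 1).const_mul _)) (integrable_const _),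
    integral_add (by exact (hi 3).sub ((hi 2).const_mul _)) ((hi 1).const_mul _),
    integral_sub (hi 3) ((hi 2).const_mul _), integral_const_mul, integral_const_mul,
    integral_rpow_pow_restrict hq, integral_rpow_pow_restrict hq, integral_rpow_pow_restrict hq]
  simp only [integral_const, probReal_univ, one_smul]
  push_cast
  field_simp
  ring

/-! ### Random variables with the uniform law -/

variable {Ω : Type*} [MeasurableSpace Ω] {P : Measure Ω} {z : Ω → ℝ}

lemma aemeasurable_of_isUniform_Icc (hz : pdf.IsUniform z (Icc (0 : ℝ) 1) P volume) :
    AEMeasurable z P :=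
  hz.aemeasurable (by simp) (by simp)

lemma integral_comp_of_isUniform_Icc (hz : pdf.IsUniform z (Icc (0 : ℝ) 1) P volume) {f : ℝ → ℝ}
    (hf : Measurable f) : ∫ ω, f (z ω) ∂P = ∫ x in Icc (0 : ℝ) 1, f x := by
  rw [← cond_volume_Icc_zero_one, ← (hz : P.map z = _),
    integral_map (aemeasurable_of_isUniform_Icc hz) hf.aestronglyMeasurable]

lemma integral_rpow_of_isUniform (hq : 0 < q)
    (hz : pdf.IsUniform z (Icc (0 : ℝ) 1) P volume) : ∫ ω, z ω ^ q ∂P = 1 / (q + 1) := by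
  rw [integral_comp_of_isUniform_Icc hz (f := fun x => x ^ q) (by fun_prop),
    integral_rpow_restrict hq]

lemma thirdCumulant_rpow_of_isUniform (hq : 0 < q)
    (hz : pdf.IsUniform z (Icc (0 : ℝ) 1) P volume) :
    thirdCumulant (fun ω => z ω ^ q) P
      = 2 * q ^ 3 * (q - 1) / ((3 * q + 1) * (2 * q + 1) * (q + 1) ^ 3) := by
  simp only [thirdCumulant, centralMoment, Pi.pow_apply, Pi.sub_apply,
    integral_rpow_of_isUniform hq hz]
  rw [integral_comp_of_isUniform_Icc hz (f := fun x => (x ^ q - 1 / (q + 1)) ^ 3) (by fun_prop),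
    integral_centered_rpow_cube_restrict hq]

lemma variance_rpow_of_isUniform (hq : 0 < q)
    (hz : pdf.IsUniform z (Icc (0 : ℝ) 1) P volume) :
    variance (fun ω => z ω ^ q) P = q ^ 2 / ((2 * q + 1) * (q + 1) ^ 2) := by
  rw [variance_eq_integral ((aemeasurable_of_isUniform_Icc hz).pow_const q),
    integral_rpow_of_isUniform hq hz,
    integral_comp_of_isUniform_Icc hz (f := fun x => (x ^ q - 1 / (q + 1)) ^ 2) (by fun_prop),
    integral_centered_rpow_sq_restrict hq]

lemma sqrt_variance_rpow_of_isUniform (hq : 0 < q)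
    (hz : pdf.IsUniform z (Icc (0 : ℝ) 1) P volume) :
    √(variance (fun ω => z ω ^ q) P) = q / (√(2 * q + 1) * (q + 1)) := by
  rw [variance_rpow_of_isUniform hq hz, Real.sqrt_div (sq_nonneg q), Real.sqrt_sq hq.le,
    Real.sqrt_mul (by linarith), Real.sqrt_sq (by linarith)]

lemma normalArg_eq_of_isUniform (hq : 0 < q)
    (hz : pdf.IsUniform z (Icc (0 : ℝ) 1) P volume) (d : ℕ) (r : ℝ) :
    normalArg d q r = (r ^ q - d * ∫ ω, z ω ^ q ∂P) /
      (√(variance (fun ω => z ω ^ q) P) * √(d : ℝ)) := by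
  have hs : 0 < √(2 * q + 1) := Real.sqrt_pos.2 (by linarith)
  rw [sqrt_variance_rpow_of_isUniform hq hz, integral_rpow_of_isUniform hq hz, normalArg]
  rcases Nat.eq_zero_or_pos d with rfl | hd
  -- for `d = 0` both sides are a division by zero
  · simp
  · have : 0 < √(d : ℝ) := Real.sqrt_pos.2 (by exact_mod_cast hd)
    field_simp

lemma improvedNormalApprox_eq_firstOrderEdgeworth (hq : 0 < q)
    (hz : pdf.IsUniform z (Icc (0 : ℝ) 1) P volume) (d : ℕ) (r : ℝ) :
    improvedNormalApprox d q r
      = firstOrderEdgeworth (fun ω => z ω ^ q) P d (normalArg d q r) := by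
  have hs : 0 < √(2 * q + 1) := Real.sqrt_pos.2 (by linarith)
  have hsq : √(2 * q + 1) ^ 2 = 2 * q + 1 := Real.sq_sqrt (by linarith)
  rw [improvedNormalApprox, firstOrderEdgeworth, sqrt_variance_rpow_of_isUniform hq hz,
    thirdCumulant_rpow_of_isUniform hq hz]
  congr 2
  have e : 2 * q ^ 3 * (q - 1) / ((3 * q + 1) * (2 * q + 1) * (q + 1) ^ 3)
      = 2 * q ^ 3 * (q - 1) / ((3 * q + 1) * √(2 * q + 1) ^ 2 * (q + 1) ^ 3) := by rw [hsq]
  rw [e]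
  field_simp

end

/-! ### The covered fraction as a probability -/

lemma measurable_lqNorm {d : ℕ} (q : ℝ) : Measurable (lqNorm q : (Fin d → ℝ) → ℝ) := by
  unfold lqNorm
  fun_prop

lemma lqNorm_nonneg {d : ℕ} (q : ℝ) (x : Fin d → ℝ) : 0 ≤ lqNorm q x :=
  Real.rpow_nonneg (Finset.sum_nonneg fun _ _ => Real.rpow_nonneg (abs_nonneg _) _) _

lemma lqNorm_rpow {d : ℕ} {q : ℝ} (hq : 0 < q) (x : Fin d → ℝ) :
    lqNorm q x ^ q = ∑ i, |x i| ^ q := by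
  rw [lqNorm, ← Real.rpow_mul
    (Finset.sum_nonneg fun _ _ => Real.rpow_nonneg (abs_nonneg _) _), one_div_mul_cancel hq.ne',
    Real.rpow_one]

lemma lqBall_eq {d : ℕ} {q r : ℝ} (hq : 0 < q) (hr : 0 < r) :
    lqBall d q r = {x | lqNorm q x ^ q ≤ r ^ q} := by
  ext x
  exact (Real.rpow_le_rpow_iff (lqNorm_nonneg q x) hr.le hq).symm

lemma measurableSet_lqBall (d : ℕ) (q r : ℝ) : MeasurableSet (lqBall d q r) :=
  measurableSet_le (measurable_lqNorm q) measurable_const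

lemma volume_cube (d : ℕ) : volume (cube d) = 2 ^ d := by
  rw [cube, volume_pi_pi]
  simp only [Real.volume_Icc, Finset.prod_const, Finset.card_univ, Fintype.card_fin]
  norm_num

lemma coveredFraction_eq_cond (d : ℕ) (q r : ℝ) :
    coveredFraction d q r = (cond volume (cube d) (lqBall d q r)).toReal := by
  rw [coveredFraction, cond_apply' (measurableSet_lqBall d q r), volume_cube, ENNReal.toReal_mul,
    ENNReal.toReal_inv, ENNReal.toReal_pow, ENNReal.toReal_ofNat, div_eq_inv_mul]

lemma coveredFraction_eq_prob_lqNorm {d : ℕ} {q r : ℝ} (hq : 0 < q) (hr : 0 < r) {Ω : Type*}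
    [MeasurableSpace Ω] {P : Measure Ω} {x : Ω → Fin d → ℝ}
    (hx : pdf.IsUniform x (cube d) P volume) :
    coveredFraction d q r = (P {ω | lqNorm q (x ω) ^ q ≤ r ^ q}).toReal := by
  have hae : AEMeasurable x P := hx.aemeasurable (by simp [volume_cube]) (by simp [volume_cube])
  rw [coveredFraction_eq_cond, ← (hx : P.map x = _),
    Measure.map_apply_of_aemeasurable hae (measurableSet_lqBall d q r), lqBall_eq hq hr]
  rfl

lemma map_abs_cond_volume_Icc :
    (cond (volume : Measure ℝ) (Icc (-1) 1)).map (fun x => |x|)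
      = volume.restrict (Icc (0 : ℝ) 1) := by
  ext A hA
  rw [Measure.map_apply (by fun_prop) hA, cond_apply measurableSet_Icc, Measure.restrict_apply hA]
  set B := A ∩ Icc (0 : ℝ) 1 with hB
  have hBm : MeasurableSet B := hA.inter measurableSet_Icc
  -- up to the null set `{0}`, the preimage is the disjoint union of `B` and `-B`
  have hset : Icc (-1 : ℝ) 1 ∩ (fun x => |x|) ⁻¹' A = B ∪ Neg.neg ⁻¹' B := by
    ext x
    simp only [hB, mem_inter_iff, mem_Icc, mem_preimage, mem_union]
    rcases le_total 0 x with hx | hx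
    · rw [abs_of_nonneg hx]
      constructor
      · rintro ⟨⟨_, h2⟩, h3⟩
        exact Or.inl ⟨h3, hx, h2⟩
      · rintro (⟨h1, h2, h3⟩ | ⟨h1, h2, h3⟩)
        · exact ⟨⟨by linarith, h3⟩, h1⟩
        · obtain rfl : x = 0 := by linarith
          simpa using h1
    · rw [abs_of_nonpos hx]
      constructor
      · rintro ⟨⟨h1, _⟩, h3⟩
        exact Or.inr ⟨h3, by linarith, by linarith⟩
      · rintro (⟨h1, h2, h3⟩ | ⟨h1, h2, h3⟩)
        · obtain rfl : x = 0 := by linarith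
          simpa using h1
        · exact ⟨⟨by linarith, by linarith⟩, h1⟩
  have hdisj : AEDisjoint volume B (Neg.neg ⁻¹' B) := by
    refine measure_mono_null (t := {0}) ?_ (by simp)
    rintro x ⟨⟨_, h1, _⟩, ⟨_, h2, _⟩⟩
    rw [mem_singleton_iff]
    linarith
  rw [hset, measure_union₀ (hBm.preimage measurable_neg).nullMeasurableSet hdisj,
    Measure.measure_preimage_neg, Real.volume_Icc, ← two_mul, ← mul_assoc]
  norm_num
  rw [ENNReal.inv_mul_cancel (by simp) (by simp), one_mul]

lemma cond_volume_cube (d : ℕ) :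
    cond volume (cube d) = Measure.pi fun _ : Fin d => cond (volume : Measure ℝ) (Icc (-1) 1) := by
  refine (Measure.pi_eq fun s hs => ?_).symm
  rw [cond_apply' (MeasurableSet.univ_pi hs), volume_cube, cube, ← pi_inter_distrib, volume_pi_pi]
  simp_rw [cond_apply measurableSet_Icc, Finset.prod_mul_distrib]
  simp only [Real.volume_Icc, Finset.prod_const, Finset.card_univ, Fintype.card_fin]
  congr 1
  rw [← ENNReal.inv_pow]
  norm_num

lemma map_abs_cond_volume_cube (d : ℕ) :
    (cond volume (cube d)).map (fun x i => |x i|)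
      = Measure.pi fun _ : Fin d => volume.restrict (Icc (0 : ℝ) 1) := by
  have : IsProbabilityMeasure (cond (volume : Measure ℝ) (Icc (-1) 1)) :=
    cond_isProbabilityMeasure_of_finite (by simp) (by simp)
  have hp : ∀ _ : Fin d, SigmaFinite
      ((cond (volume : Measure ℝ) (Icc (-1) 1)).map (fun x => |x|)) := fun _ => by
    rw [map_abs_cond_volume_Icc]
    infer_instance
  rw [cond_volume_cube, Measure.pi_map_pi (f := fun _ x => |x|) fun _ => by fun_prop]
  simp_rw [map_abs_cond_volume_Icc]

lemma coveredFraction_eq_pi {d : ℕ} {q r : ℝ} (hq : 0 < q) (hr : 0 < r) :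
    coveredFraction d q r = ((Measure.pi fun _ : Fin d => volume.restrict (Icc (0 : ℝ) 1))
      {x | ∑ i, x i ^ q ≤ r ^ q}).toReal := by
  rw [coveredFraction_eq_cond, lqBall_eq hq hr, ← map_abs_cond_volume_cube,
    Measure.map_apply (by fun_prop) (measurableSet_le (by fun_prop) measurable_const)]
  simp_rw [lqNorm_rpow hq]
  rfl

lemma coveredFraction_eq_prob_sum {d : ℕ} {q r : ℝ} (hq : 0 < q) (hr : 0 < r) {Ω : Type*}
    [MeasurableSpace Ω] {P : Measure Ω} {z : Fin d → Ω → ℝ} (hind : iIndepFun z P)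
    (hz : ∀ i, pdf.IsUniform (z i) (Icc (0 : ℝ) 1) P volume) :
    coveredFraction d q r = (P {ω | ∑ i, z i ω ^ q ≤ r ^ q}).toReal := by
  have hae (i : Fin d) := aemeasurable_of_isUniform_Icc (hz i)
  have hmap := hind.map_fun_eq_pi_map hae
  have hlaw (i : Fin d) : P.map (z i) = volume.restrict (Icc (0 : ℝ) 1) :=
    Eq.trans (hz i) cond_volume_Icc_zero_one
  simp_rw [hlaw] at hmap
  rw [coveredFraction_eq_pi hq hr, ← hmap,
    Measure.map_apply_of_aemeasurable (aemeasurable_pi_lambda _ hae)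
      (measurableSet_le (by fun_prop) measurable_const)]
  rfl

/-! ### The expansion for sums of powers of uniform variables -/

/-- The law of `z ^ q - 𝔼 (z ^ q)` for `z` uniform on `[0, 1]`. -/
noncomputable def centeredPowerLaw (q : ℝ) : Measure ℝ :=
  (volume.restrict (Icc (0 : ℝ) 1)).map fun z => z ^ q - 1 / (q + 1)

instance isProbabilityMeasure_centeredPowerLaw (q : ℝ) :
    IsProbabilityMeasure (centeredPowerLaw q) :=
  Measure.isProbabilityMeasure_map (by fun_prop)

section

variable {q : ℝ}

lemma integral_centeredPowerLaw (q : ℝ) {f : ℝ → ℝ} (hf : Measurable f) :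
    ∫ x, f x ∂(centeredPowerLaw q) = ∫ z in Icc (0 : ℝ) 1, f (z ^ q - 1 / (q + 1)) :=
  integral_map (by fun_prop) hf.aestronglyMeasurable

lemma abs_le_one_centeredPowerLaw (hq : 0 < q) : ∀ᵐ x ∂(centeredPowerLaw q), |x| ≤ 1 := by
  rw [centeredPowerLaw, ae_map_iff (by fun_prop) (measurableSet_le (by fun_prop) (by fun_prop))]
  filter_upwards [ae_restrict_mem measurableSet_Icc] with z hz
  have h1 := Real.rpow_nonneg hz.1 q
  have h2 := Real.rpow_le_one hz.1 hz.2 hq.le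
  have h3 : 1 / (q + 1) ≤ 1 := by
    rw [div_le_one (by linarith)]
    linarith
  have h4 : 0 < 1 / (q + 1) := by positivity
  rw [abs_le]
  constructor <;> linarith

lemma norm_charFun_centeredPowerLaw (q s : ℝ) :
    ‖charFun (centeredPowerLaw q) s‖
      = ‖∫ z in (0 : ℝ)..1, Complex.exp (s * (z ^ q : ℝ) * Complex.I)‖ := by
  have h : charFun (centeredPowerLaw q) s
      = Complex.exp ((-(s * (1 / (q + 1))) : ℝ) * Complex.I)
        * ∫ z in (0 : ℝ)..1, Complex.exp (s * (z ^ q : ℝ) * Complex.I) := by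
    rw [charFun_apply_real, centeredPowerLaw, integral_map (by fun_prop) (by fun_prop),
      intervalIntegral.integral_of_le zero_le_one, ← integral_Icc_eq_integral_Ioc,
      ← integral_const_mul]
    congr 1
    ext z
    rw [← Complex.exp_add]
    congr 1
    push_cast
    ring
  rw [h, norm_mul, Complex.norm_exp_ofReal_mul_I, one_mul]

/-- The law of the centred sum `∑ i, (z i ^ q - 𝔼 (z i ^ q))` for independent `z i` uniform on
`[0, 1]`. -/
noncomputable def centeredSumLaw (d : ℕ) (q : ℝ) : Measure ℝ :=
  (Measure.pi fun _ : Fin d => centeredPowerLaw q).map fun x => ∑ i, x i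

instance isProbabilityMeasure_centeredSumLaw (d : ℕ) (q : ℝ) :
    IsProbabilityMeasure (centeredSumLaw d q) :=
  Measure.isProbabilityMeasure_map (by fun_prop)

lemma charFun_centeredSumLaw (d : ℕ) (q s : ℝ) :
    charFun (centeredSumLaw d q) s = charFun (centeredPowerLaw q) s ^ d := by
  rw [centeredSumLaw, charFun_map_sum_pi_eq_prod]
  simp

lemma integrable_id_centeredSumLaw (d : ℕ) (hq : 0 < q) :
    Integrable id (centeredSumLaw d q) := by
  have hm : Measurable fun x : Fin d → ℝ => ∑ i, x i := by fun_prop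
  rw [centeredSumLaw, integrable_map_measure aestronglyMeasurable_id hm.aemeasurable]
  change Integrable (fun x : Fin d → ℝ => ∑ i, x i) _
  refine integrable_finsetSum _ fun i _ => ?_
  have h : Integrable id (centeredPowerLaw q) := by
    have := integrable_pow_of_abs_le_one (abs_le_one_centeredPowerLaw hq) 1
    exact this.congr (ae_of_all _ fun x => pow_one x)
  have hi := measurePreserving_eval (fun _ : Fin d => centeredPowerLaw q) i
  exact hi.integrable_comp_of_integrable h

lemma centeredSumLaw_eq (d : ℕ) (q : ℝ) :
    centeredSumLaw d q = (Measure.pi fun _ : Fin d => volume.restrict (Icc (0 : ℝ) 1)).map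
      fun x => ∑ i, (x i ^ q - 1 / (q + 1)) := by
  have h := Measure.pi_map_pi (μ := fun _ : Fin d => volume.restrict (Icc (0 : ℝ) 1))
    (f := fun _ z => z ^ q - 1 / (q + 1)) (hμ := fun _ => by
      have := isProbabilityMeasure_centeredPowerLaw q
      rw [centeredPowerLaw] at this
      infer_instance) fun _ => by fun_prop
  simp only [centeredSumLaw, centeredPowerLaw]
  rw [← h, Measure.map_map (by fun_prop) (by fun_prop)]
  rfl

lemma coveredFraction_eq_cdf {d : ℕ} {r : ℝ} (hq : 0 < q) (hr : 0 < r) :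
    coveredFraction d q r = cdf (centeredSumLaw d q) (r ^ q - d * (1 / (q + 1))) := by
  rw [coveredFraction_eq_pi hq hr, cdf_eq_real, centeredSumLaw_eq,
    map_measureReal_apply (by fun_prop) measurableSet_Iic]
  rw [measureReal_def]
  congr 2
  ext x
  simp [Finset.sum_sub_distrib]

/-- In the variable `r ^ q - d 𝔼 (z ^ q)`, the approximation is the unnormalized Edgeworth
approximation. -/
lemma improvedNormalApprox_eq_edgeworthCDF {d : ℕ} (r : ℝ) (hq : 0 < q) (hd : 1 ≤ d) :
    improvedNormalApprox d q r
      = edgeworthCDF (d * ∫ x, x ^ 2 ∂(centeredPowerLaw q)).toNNReal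
          (d * ∫ x, x ^ 3 ∂(centeredPowerLaw q)) (r ^ q - d * (1 / (q + 1))) := by
  have hd0 : (0 : ℝ) < d := by exact_mod_cast hd
  have hsd : 0 < √(d : ℝ) := Real.sqrt_pos.2 hd0
  have hsd2 : √(d : ℝ) ^ 2 = d := Real.sq_sqrt hd0.le
  have hU := isUniform_id_Icc
  have hvar := variance_rpow_of_isUniform hq hU
  have hcum := thirdCumulant_rpow_of_isUniform hq hU
  have hmean := integral_rpow_of_isUniform hq hU
  have harg := normalArg_eq_of_isUniform hq hU d r
  rw [improvedNormalApprox_eq_firstOrderEdgeworth hq hU, firstOrderEdgeworth, harg, hmean]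
  rw [integral_centeredPowerLaw q (f := fun x => x ^ 2) (by fun_prop),
    integral_centeredPowerLaw q (f := fun x => x ^ 3) (by fun_prop),
    integral_centered_rpow_sq_restrict hq, integral_centered_rpow_cube_restrict hq,
    ← hvar, ← hcum]
  set v := variance (fun ω => id ω ^ q) (volume.restrict (Icc (0 : ℝ) 1))
  set m := thirdCumulant (fun ω => id ω ^ q) (volume.restrict (Icc (0 : ℝ) 1))
  have hv : 0 < v := by
    rw [hvar]
    positivity
  have hsv : 0 < √v := Real.sqrt_pos.2 hv
  have hdv : (d * v).toNNReal ≠ 0 := (Real.toNNReal_pos.2 (by positivity)).ne'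
  rw [edgeworthCDF_eq hdv, Real.coe_toNNReal _ (by positivity), Real.sqrt_mul hd0.le,
    mul_comm √v]
  congr 1
  have e : (d : ℝ) * m / (√(d : ℝ) * √v) ^ 3 = m / (√(d : ℝ) * √v ^ 3) := by
    rw [mul_pow, pow_succ √(d : ℝ), hsd2]
    field_simp
  rw [e]
  field_simp

/-- The error of the approximation is `O(1 / d)`, uniformly in the radius. -/
lemma exists_abs_coveredFraction_sub_le (hq : 0 < q) :
    ∃ K ρ : ℝ, 0 ≤ ρ ∧ ρ < 1 ∧ ∀ d : ℕ, 2 ≤ d → ∀ r : ℝ, 0 < r →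
      |coveredFraction d q r - improvedNormalApprox d q r| ≤ K * (1 / d + ρ ^ d) := by
  have h1 : ∫ x, x ∂(centeredPowerLaw q) = 0 := by
    rw [integral_centeredPowerLaw q (f := fun x => x) (by fun_prop),
      integral_centered_rpow_restrict hq]
  have hv : 0 < ∫ x, x ^ 2 ∂(centeredPowerLaw q) := by
    rw [integral_centeredPowerLaw q (f := fun x => x ^ 2) (by fun_prop),
      integral_centered_rpow_sq_restrict hq]
    positivity
  obtain ⟨K, ρ, hρ0, hρ1, h⟩ := exists_abs_cdf_sub_edgeworthCDF_le
    (abs_le_one_centeredPowerLaw hq) h1 hv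
    (fun s hs => by
      rw [norm_charFun_centeredPowerLaw]
      exact norm_integral_exp_mul_rpow_lt_one hq hs)
    (α := 1 / (q + 1)) (by positivity)
    (fun s => by
      rw [norm_charFun_centeredPowerLaw]
      exact norm_integral_exp_mul_rpow_le hq s)
  refine ⟨K, ρ, hρ0, hρ1, fun d hd r hr => ?_⟩
  rw [coveredFraction_eq_cdf hq hr, improvedNormalApprox_eq_edgeworthCDF r hq (by omega)]
  exact h d hd _ (integrable_id_centeredSumLaw d hq) (charFun_centeredSumLaw d q) _

end

lemma tendsto_sqrt_mul_one_div_add_pow (K : ℝ) {ρ : ℝ} (h0 : 0 ≤ ρ) (h1 : ρ < 1) :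
    Tendsto (fun d : ℕ => √(d : ℝ) * (K * (1 / d + ρ ^ d))) atTop (𝓝 0) := by
  have hsqrt : Tendsto (fun d : ℕ => √(d : ℝ) * (1 / d)) atTop (𝓝 0) := by
    have h : Tendsto (fun d : ℕ => (√(d : ℝ))⁻¹) atTop (𝓝 0) :=
      tendsto_inv_atTop_zero.comp (Real.tendsto_sqrt_atTop.comp tendsto_natCast_atTop_atTop)
    refine h.congr fun d => ?_
    rw [mul_one_div, Real.sqrt_div_self]
  have hgeom : Tendsto (fun d : ℕ => √(d : ℝ) * ρ ^ d) atTop (𝓝 0) := by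
    refine squeeze_zero (fun d => by positivity) (fun d => ?_)
      (tendsto_self_mul_const_pow_of_lt_one h0 h1)
    have : √(d : ℝ) ≤ d := by
      rcases Nat.eq_zero_or_pos d with rfl | hd
      · simp
      · exact Real.sqrt_le_self_iff.2 (Or.inr (by exact_mod_cast hd))
    gcongr
  have h := (hsqrt.add hgeom).const_mul K
  rw [add_zero, mul_zero] at h
  refine h.congr fun d => ?_
  ring

theorem mainTheorem2 (q : ℝ) (hq : 0 < q) :
    -- the covered fraction in terms of a uniform random point of the cube
    (∀ (d : ℕ) (r : ℝ), 1 ≤ d → 0 < r →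
      ∀ (Ω : Type*) [MeasurableSpace Ω] (P : Measure Ω) [IsProbabilityMeasure P]
        (x : Ω → Fin d → ℝ), pdf.IsUniform x (cube d) P volume →
        coveredFraction d q r = (P {ω | lqNorm q (x ω) ^ q ≤ r ^ q}).toReal) ∧
    -- the covered fraction in terms of independent uniform variables on the unit interval
    (∀ (d : ℕ) (r : ℝ), 1 ≤ d → 0 < r →
      ∀ (Ω : Type*) [MeasurableSpace Ω] (P : Measure Ω) [IsProbabilityMeasure P]
        (z : Fin d → Ω → ℝ), iIndepFun z P →
        (∀ i, pdf.IsUniform (z i) (Icc (0 : ℝ) 1) P volume) →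
        coveredFraction d q r = (P {ω | ∑ i, z i ω ^ q ≤ r ^ q}).toReal) ∧
    -- the third cumulant of `z ^ q`, and the approximation as a first-order Edgeworth expansion
    (∀ (Ω : Type*) [MeasurableSpace Ω] (P : Measure Ω) [IsProbabilityMeasure P]
      (z : Ω → ℝ), pdf.IsUniform z (Icc (0 : ℝ) 1) P volume →
      thirdCumulant (fun ω => z ω ^ q) P
          = 2 * q ^ 3 * (q - 1) / ((3 * q + 1) * (2 * q + 1) * (q + 1) ^ 3) ∧
      ∀ (d : ℕ) (r : ℝ), 1 ≤ d → 0 < r →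
        normalArg d q r = (r ^ q - d * ∫ ω, z ω ^ q ∂P) /
            (√(variance (fun ω => z ω ^ q) P) * √(d : ℝ)) ∧
        improvedNormalApprox d q r
          = firstOrderEdgeworth (fun ω => z ω ^ q) P d (normalArg d q r)) ∧
    -- the error is `o(d ^ (-1/2))`, uniformly in the radius
    (∀ ε : ℝ, 0 < ε → ∃ D : ℕ, ∀ d : ℕ, D ≤ d → 1 ≤ d → ∀ r : ℝ, 0 < r →
      |coveredFraction d q r - improvedNormalApprox d q r| ≤ ε / √(d : ℝ)) := by
  refine ⟨fun d r _ hr Ω _ P _ x hx => coveredFraction_eq_prob_lqNorm hq hr hx,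
    fun d r _ hr Ω _ P _ z hind hz => coveredFraction_eq_prob_sum hq hr hind hz,
    fun Ω _ P _ z hz => ⟨thirdCumulant_rpow_of_isUniform hq hz, fun d r _ _ =>
      ⟨normalArg_eq_of_isUniform hq hz d r,
        improvedNormalApprox_eq_firstOrderEdgeworth hq hz d r⟩⟩,
    fun ε hε => ?_⟩
  obtain ⟨K, ρ, hρ0, hρ1, h⟩ := exists_abs_coveredFraction_sub_le hq
  obtain ⟨D, hD⟩ := eventually_atTop.1
    ((tendsto_sqrt_mul_one_div_add_pow K hρ0 hρ1).eventually_le_const hε)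
  refine ⟨max D 2, fun d hd hd1 r hr => ?_⟩
  have hsd : 0 < √(d : ℝ) := Real.sqrt_pos.2 (by exact_mod_cast hd1)
  rw [le_div_iff₀ hsd, mul_comm]
  refine le_trans ?_ (hD d (le_of_max_le_left hd))
  exact mul_le_mul_of_nonneg_left (h d (le_of_max_le_right hd) r hr) hsd.le
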